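/- Let $M$ be a lattice of rank $n$ with a fixed basis, let $T_M=\operatorname{Hom}(M,\mathbb C^*)\cong(\mathbb C^*)^n$ be the torus with coordinates $\mathbf x=(x_1,\dots,x_n)$ given by the basis, and let $A\subset M$ be a finite nonempty set. Put $\phi_A:T_M\to\mathbb P^{|A|-1}$, $\phi_A(\mathbf x)=(\mathbf x^{u})_{u\in A}$, and let $X_A$ be the Zariski closure of $\phi_A(T_M)$. (The same notation is used for finite subsets of other lattices.) Let $k\ge 0$ and $q=\binom{n+k}{k}$. The matrix of $k$-jets $[J^{A}_{k,t}]$ at $t\in T_M$ has as columns the partial derivatives $\partial^\alpha(\mathbf x^{u})(t)$, $|\alpha|\le k$, for $u\in A$. Assume that $A$ is generically $k$-jet spanned, i.e. $\max_{t\in T_M}\operatorname{rk}[J^{A}_{k,t}]=q$. The Gauss map of order $k$ is the rational map $\gamma^k$ from $X_A$ to the Grassmannian $\mathrm{Gr}$ of $q$-dimensional subspaces of $\mathbb C^{A}$ that sends $\phi_A(t)$ to the $k$-th osculating space, i.e. the row space of $[J^{A}_{k,t}]$. We write $\gamma^k|_{T_M}$ for $\gamma^k\circ\phi_A$, and regard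 $\mathrm{Gr}$ as a subvariety of $\mathbb P(\bigwedge^q\mathbb C^{A})$ by the Plücker embedding. Let $$B_k=\Big\{\sum_{u\in S}u\ \Big|\ S\subseteq A,\ |S|=q,\ \det[J^{S}_{k,(1,\dots,1)}]\neq 0\Big\},$$ let $\langle B_k-B_k\rangle$ be the subgroup of $M$ generated by the differences of elements of $B_k$, and let $\pi:M\to M'=M/(\langle B_k-B_k\rangle_{\mathbb R}\cap M)$ be the projection. Two projective varieties $X_i\subseteq\mathbb P^{N_i}$ $(i=1,2)$ are called projectively equivalent if there are linear embeddings $j_i:\mathbb P^{N_i}\hookrightarrow\mathbb P^{N}$ with $j_1(X_1)=j_2(X_2)$. Then $\gamma^k$ is well defined on $\phi_A(T_M)$ (the row space of $[J^{A}_{k,t}]$ has dimension $q$ for all $t\in T_M$ and depends only on $\phi_A(t)$), and the following hold. (i) The closure $\overline{\gamma^k(X_A)}$ is projectively equivalent to $X_{B_k}$. (ii) The set $B_k$ is nonempty, the morphism of tori $T_M\to T_{\langle B_k-B_k\rangle}$ induced by the inclusion $\langle B_k-B_k\rangle\hookrightarrow M$ is surjective, and $\gamma^k|_{T_M}$ is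 this morphism, when $T_{\langle B_k-B_k\rangle}$ is regarded as the dense torus of $X_{B_k}\cong\overline{\gamma^k(X_A)}$. Precisely: for $u_0\in B_k$ let $\iota:T_{\langle B_k-B_k\rangle}\to X_{B_k}$ be $s\mapsto(s(u-u_0))_{u\in B_k}$, which as a map to projective space does not depend on $u_0$. Then $\iota$ is injective, and there is a linear embedding $j:\mathbb P^{|B_k|-1}\hookrightarrow\mathbb P(\bigwedge^q\mathbb C^{A})$ such that $j(X_{B_k})=\overline{\gamma^k(X_A)}$ and $\gamma^k(\phi_A(t))=j\big(\iota(t|_{\langle B_k-B_k\rangle})\big)$ for all $t\in T_M$ and every $u_0\in B_k$. (iii) Let $F$ be an irreducible component of a nonempty fiber of $\gamma^k|_{T_M}$, with the reduced structure. Then $F$ is a translate, by an element of $T_M$, of $T_{M'}$ (embedded in $T_M$ by $\pi$), and the closure $\overline{\phi_A(F)}$ is projectively equivalent to $X_{\pi(A)}$. In particular every nonempty fiber of $\gamma^k|_{T_M}$ has dimension $\operatorname{rk}M'=n-\operatorname{rk}\langle B_k-B_k\rangle$. -/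

import Mathlib

open scoped LinearAlgebra.Projectivization TensorProduct

noncomputable section

namespace ToricGauss

/-! ### Algebraic tori -/

/-- The complex points of the algebraic torus `T_M = Spec ℂ[M]` of an abelian group `M`:
the characters `M → ℂˣ`.  The value of the monomial `x^u` at `t` is `t u`. -/
def AlgTorus (M : Type*) [AddCommGroup M] : Type _ := Multiplicative M →* ℂˣ

section Torus

variable {M M' : Type*} [AddCommGroup M] [AddCommGroup M']

instance : CommGroup (AlgTorus M) := inferInstanceAs (CommGroup (Multiplicative M →* ℂˣ))

/-- The value `x^u(t)` of the monomial with exponent `u` at the point `t` of the torus. -/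
def AlgTorus.mon (t : AlgTorus M) (u : M) : ℂˣ :=
  (show Multiplicative M →* ℂˣ from t) (Multiplicative.ofAdd u)

/-- The value at a point of the torus of a regular function, i.e. of an element of the group
ring `ℂ[M]`. -/
def AlgTorus.evalAt (t : AlgTorus M) (f : AddMonoidAlgebra ℂ M) : ℂ :=
  f.coeff.sum fun u c => c * (t.mon u : ℂ)

/-- The Zariski topology on the torus `T_M`: it is generated by the principal open sets
`{f ≠ 0}` with `f ∈ ℂ[M]`. -/
instance : TopologicalSpace (AlgTorus M) :=
  TopologicalSpace.generateFrom {U | ∃ f : AddMonoidAlgebra ℂ M, U = {t | t.evalAt f ≠ 0}}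

/-- The morphism of tori `T_{M'} → T_M` induced by a homomorphism `M → M'`. -/
def AlgTorus.map (f : M →+ M') : AlgTorus M' →* AlgTorus M :=
  MonoidHom.compHom' (AddMonoidHom.toMultiplicative f)

end Torus

/-! ### Projective varieties -/

section Projective

variable {V W : Type*} [AddCommGroup V] [Module ℂ V] [AddCommGroup W] [Module ℂ W]

/-- The homogeneous polynomial `F` in linear forms on `V` vanishes at the point `p ∈ ℙ(V)`.
(For `V = ℂ^{N+1}`, polynomials in all linear forms define the same functions as
polynomials in the `N+1` coordinates.) -/
def VanishesAt (F : MvPolynomial (Module.Dual ℂ V) ℂ) (p : ℙ ℂ V) : Prop :=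
  MvPolynomial.eval (fun l : Module.Dual ℂ V => l p.rep) F = 0

/-- The Zariski closure of a subset of the projective space `ℙ(V)`. -/
def zariskiClosure (S : Set (ℙ ℂ V)) : Set (ℙ ℂ V) :=
  {p | ∀ (F : MvPolynomial (Module.Dual ℂ V) ℂ) (d : ℕ), F.IsHomogeneous d →
    (∀ s ∈ S, VanishesAt F s) → VanishesAt F p}

/-- Projective equivalence of `X₁ ⊆ ℙ(V)` and `X₂ ⊆ ℙ(W)`: there are embeddings `j₁, j₂` into a
common projective space `ℙ^N` that pull `O(1)` back to `O(1)`, that is, embeddings induced by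
injective linear maps, with `j₁(X₁) = j₂(X₂)`. -/
def ProjEquiv (X₁ : Set (ℙ ℂ V)) (X₂ : Set (ℙ ℂ W)) : Prop :=
  ∃ (N : ℕ) (f₁ : V →ₗ[ℂ] (Fin (N + 1) → ℂ)) (f₂ : W →ₗ[ℂ] (Fin (N + 1) → ℂ))
    (h₁ : Function.Injective f₁) (h₂ : Function.Injective f₂),
    Projectivization.map f₁ h₁ '' X₁ = Projectivization.map f₂ h₂ '' X₂

/-- The image of `⋀^q W` in `⋀^q V`.  If `dim W = q`, this is a line in `⋀^q V`, namely the image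
of the point `W` of the Grassmannian under the Plücker embedding. -/
def pluckerLine (q : ℕ) (W : Submodule ℂ V) : Submodule ℂ (⋀[ℂ]^q V) :=
  Submodule.span ℂ {ω | ∃ w : Fin q → V, (∀ i, w i ∈ W) ∧ ω = exteriorPower.ιMulti ℂ q w}

end Projective

/-! ### Toric varieties given by a finite set of lattice points -/

section Toric

variable {M : Type*} [AddCommGroup M]

/-- The map `φ_A : T_M → ℙ^{|A|-1}`, `x ↦ (x^u)_{u ∈ A}`. -/
def toricMap (A : Finset M) (hA : A.Nonempty) (t : AlgTorus M) : ℙ ℂ (A → ℂ) :=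
  Projectivization.mk ℂ (fun u : A => (t.mon u : ℂ)) fun h =>
    (t.mon hA.choose).ne_zero (congrFun h ⟨hA.choose, hA.choose_spec⟩)

/-- The toric variety `X_A`, the Zariski closure of the image of `φ_A`. -/
def toricVariety (A : Finset M) : Set (ℙ ℂ (A → ℂ)) :=
  zariskiClosure {p | ∃ (hA : A.Nonempty) (t : AlgTorus M), p = toricMap A hA t}

/-- The lattice `⟨B - B⟩` generated by the differences of elements of `B`. -/
def diffLattice (B : Finset M) : AddSubgroup M :=
  AddSubgroup.closure {m | ∃ u ∈ B, ∃ v ∈ B, m = u - v}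

theorem sub_mem_diffLattice {B : Finset M} {u v : M} (hu : u ∈ B) (hv : v ∈ B) :
    u - v ∈ diffLattice B :=
  AddSubgroup.subset_closure ⟨u, hu, v, hv, rfl⟩

/-- The inclusion of `T_{⟨B - B⟩}` in `X_B` as its dense torus:
`s ↦ (s^{u - u₀})_{u ∈ B}`.  As a point of the projective space, the image does not depend on
the choice of `u₀ ∈ B`. -/
def torusInclusion (B : Finset M) (u₀ : M) (h₀ : u₀ ∈ B) (s : AlgTorus (diffLattice B)) :
    ℙ ℂ (B → ℂ) :=
  Projectivization.mk ℂ
    (fun u : B => (s.mon ⟨(u : M) - u₀, sub_mem_diffLattice u.2 h₀⟩ : ℂ)) fun h =>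
    (s.mon ⟨u₀ - u₀, sub_mem_diffLattice h₀ h₀⟩).ne_zero (congrFun h ⟨u₀, h₀⟩)

/-- `L_ℝ ∩ M`: the elements of `M` whose image in `M_ℝ = ℝ ⊗ M` lies in the real span of `L`. -/
def realSpanInter (L : AddSubgroup M) : AddSubgroup M :=
  (Submodule.span ℝ ((fun m : M => (1 : ℝ) ⊗ₜ[ℤ] m) '' (L : Set M))).toAddSubgroup.comap
    (TensorProduct.mk ℤ ℝ M 1).toAddMonoidHom

open Classical in
/-- The image in `M / S` of a finite subset of `M`. -/
def projSet (S : AddSubgroup M) (A : Finset M) : Finset (M ⧸ S) :=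
  A.image (QuotientAddGroup.mk' S)

end Toric

/-! ### Jets, osculating spaces and Gauss maps -/

section Jets

/-- The multi-indices `α ∈ ℕⁿ` with `|α| ≤ k`. -/
def MultiIndex (n k : ℕ) : Type := {α : Fin n → ℕ // ∑ i, α i ≤ k}

/-- The partial derivative with respect to the `i`-th coordinate of `ℂⁿ`. -/
def partialDeriv {n : ℕ} (i : Fin n) (f : (Fin n → ℂ) → ℂ) : (Fin n → ℂ) → ℂ :=
  fun z => lineDeriv ℂ f z (Pi.single i 1)

/-- The iterated partial derivative `∂^α = ∂₁^{α₁} ⋯ ∂ₙ^{αₙ}`. -/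
def mixedDeriv {n : ℕ} (α : Fin n → ℕ) (f : (Fin n → ℂ) → ℂ) : (Fin n → ℂ) → ℂ :=
  (List.finRange n).foldr (fun i g => (partialDeriv i)^[α i] g) f

variable {M : Type*} [AddCommGroup M] {n : ℕ} (b : Module.Basis (Fin n) ℤ M)

/-- The Laurent monomial `x^u = ∏ xᵢ^{uᵢ}`, in the coordinates of `T_M` given by a basis. -/
def monomialFun (u : M) : (Fin n → ℂ) → ℂ := fun z => ∏ i, z i ^ (b.repr u i)

/-- The coordinates `(x₁, …, xₙ)` of a point of `T_M ≅ (ℂˣ)ⁿ`. -/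
def coords (t : AlgTorus M) : Fin n → ℂ := fun i => (t.mon (b i) : ℂ)

/-- The matrix of `k`-jets of `φ_A` at the point `t`: its columns list the partial derivatives of
order at most `k` of the monomials `x^u`, `u ∈ A`. -/
def jetMatrix (A : Finset M) (k : ℕ) (t : AlgTorus M) : Matrix (MultiIndex n k) A ℂ :=
  Matrix.of fun α u => mixedDeriv α.1 (monomialFun b (u : M)) (coords b t)

/-- The general `k`-th osculating dimension `d_k`: the maximal rank of the matrix of `k`-jets,
which is the rank at a general point. -/
def generalOscDim (A : Finset M) (k : ℕ) : ℕ := ⨆ t : AlgTorus M, (jetMatrix b A k t).rank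

/-- `A` is generically `k`-jet spanned: `d_k = C(n+k, k)`. -/
def GenericallyJetSpanned (A : Finset M) (k : ℕ) : Prop :=
  generalOscDim b A k = (n + k).choose k

/-- The matrix of `k`-jets of `φ_S` at the point `(1, …, 1)` is a square matrix of size
`C(n+k, k)` with nonzero determinant.  (Whether this holds does not depend on the order chosen
for the rows and the columns.) -/
def NonsingularJets (S : Finset M) (k : ℕ) : Prop :=
  ∃ (r : Fin ((n + k).choose k) ≃ MultiIndex n k) (c : Fin ((n + k).choose k) ≃ S),
    ((jetMatrix b S k 1).submatrix r c).det ≠ 0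

open Classical in
/-- The set `B_k` of the sums `u₁ + ⋯ + u_q` of those subsets of `A` with `q = C(n+k, k)`
elements whose matrix of `k`-jets at `(1, …, 1)` is nonsingular. -/
def jetSums (A : Finset M) (k : ℕ) : Finset M :=
  ((A.powersetCard ((n + k).choose k)).filter fun S => NonsingularJets b S k).image
    fun S => ∑ u ∈ S, u

/-- The `k`-th Gauss map on the torus, `t ↦ γ^k(φ_A(t))`: the `k`-th osculating space of `X_A` at
`φ_A(t)`, as a linear subspace of `ℂ^{|A|}`.  It is spanned by the rows of the matrix of `k`-jets,
that is, by `φ_A` and its partial derivatives of order at most `k`. -/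
def gaussMap (A : Finset M) (k : ℕ) (t : AlgTorus M) : Submodule ℂ (A → ℂ) :=
  Submodule.span ℂ (Set.range fun α : MultiIndex n k => (jetMatrix b A k t) α)

/-- The closure of `γ^k(X_A)` in the Plücker embedding of the Grassmannian of `C(n+k, k)`-dimensional
subspaces.  Since `γ^k` is a rational map, the closure of its image is the closure of the image of
the dense torus of `X_A`. -/
def osculatingVariety (A : Finset M) (k : ℕ) :
    Set (ℙ ℂ (⋀[ℂ]^((n + k).choose k) (A → ℂ))) :=
  zariskiClosure {p | ∃ t : AlgTorus M,
    p.submodule = pluckerLine ((n + k).choose k) (gaussMap b A k t)}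

/-- The fiber through `t₀` of the restriction of `γ^k` to the torus. -/
def gaussFiber (A : Finset M) (k : ℕ) (t₀ : AlgTorus M) : Set (AlgTorus M) :=
  {t | gaussMap b A k t = gaussMap b A k t₀}

end Jets

/-- `F` is an irreducible component of the subset `Z` of a topological space. -/
def IsIrredComponent {X : Type*} [TopologicalSpace X] (Z F : Set X) : Prop :=
  Maximal (fun S : Set X => IsIrreducible S ∧ S ⊆ Z) F

end ToricGauss

end

/-! A partial derivative of a Laurent monomial is a constant times a shifted monomial. So the jet
matrix at `t` is the one at `(1, …, 1)`, multiplied on the left by an invertible diagonal matrix and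
on the right by `diag(t^u)` (`jetMatrix_row`). Hence the osculating space at `t` is the image of the
one at `1` under the diagonal torus action on `ℂ^A` (`gaussMap_eq_map`).

On `⋀^q ℂ^A` the basis vector `e_S` is an eigenvector of weight `∑_{u ∈ S} u`, and the
`e_S`-coordinate of the Plücker vector at `1` is the minor `det J^S`. So the weights that occur form
exactly `B_k`, and the Plücker vector at `t` is the image of `(t^m)_{m ∈ B_k}` under a fixed linear
map, injective because each weight in `B_k` has a nonzero coordinate (`weightMap_mon`,
`weightMap_injective`). Linear embeddings commute with Zariski closure (`image_map_zariskiClosure`);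
this gives (i) and (ii).

As the Plücker embedding is injective, a fiber of `γ^k` consists of the points with prescribed
values on `L = ⟨B_k - B_k⟩` (`gaussMap_eq_iff`). If `N • m ∈ L` with `N ≠ 0`, then `t(m)` takes
finitely many values on the fiber, so an irreducible subset lies in one coset of `T_{M'}`; cosets
are irreducible because `M'` is free. On such a coset the coordinates of `φ_A` are those of
`φ_{π(A)}`, repeated and rescaled, whence (iii). The fiber dimension is that of the torus `T_{M'}`,
bounded above by chains of primes and below by coordinate subtori. -/

noncomputable section

namespace ToricGauss

/-! ### Points of a torus, regular functions and the Zariski topology -/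

section TorusBasics

variable {M M' : Type*} [AddCommGroup M] [AddCommGroup M']

namespace AlgTorus

@[ext] theorem ext {s t : AlgTorus M} (h : ∀ u, s.mon u = t.mon u) : s = t :=
  MonoidHom.ext (M := Multiplicative M) (N := ℂˣ) fun u => h u.toAdd

@[simp] theorem mon_add (t : AlgTorus M) (u v : M) : t.mon (u + v) = t.mon u * t.mon v :=
  map_mul (show Multiplicative M →* ℂˣ from t) _ _

@[simp] theorem mon_zero (t : AlgTorus M) : t.mon 0 = 1 :=
  map_one (show Multiplicative M →* ℂˣ from t)

@[simp] theorem mon_neg (t : AlgTorus M) (u : M) : t.mon (-u) = (t.mon u)⁻¹ :=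
  map_inv (show Multiplicative M →* ℂˣ from t) _

@[simp] theorem mon_sub (t : AlgTorus M) (u v : M) : t.mon (u - v) = t.mon u / t.mon v :=
  map_div (show Multiplicative M →* ℂˣ from t) _ _

@[simp] theorem mon_zsmul (t : AlgTorus M) (k : ℤ) (u : M) : t.mon (k • u) = t.mon u ^ k :=
  map_zpow (show Multiplicative M →* ℂˣ from t) _ k

theorem mon_sum {ι : Type*} (t : AlgTorus M) (s : Finset ι) (f : ι → M) :
    t.mon (∑ i ∈ s, f i) = ∏ i ∈ s, t.mon (f i) := by
  classical
  induction s using Finset.induction_on with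
  | empty => simp
  | insert a s ha ih => simp [Finset.sum_insert ha, Finset.prod_insert ha, ih]

@[simp] theorem one_mon (u : M) : (1 : AlgTorus M).mon u = 1 := rfl

@[simp] theorem mul_mon (s t : AlgTorus M) (u : M) : (s * t).mon u = s.mon u * t.mon u := rfl

@[simp] theorem div_mon (s t : AlgTorus M) (u : M) : (s / t).mon u = s.mon u / t.mon u := rfl

@[simp] theorem map_mon (f : M →+ M') (t : AlgTorus M') (u : M) :
    (map f t).mon u = t.mon (f u) := rfl

/-- The point of the torus given by an additive homomorphism to the unit group. -/
def ofHom (f : M →+ Additive ℂˣ) : AlgTorus M := AddMonoidHom.toMultiplicativeLeft f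

@[simp] theorem ofHom_mon (f : M →+ Additive ℂˣ) (u : M) : (ofHom f).mon u = (f u).toMul := rfl

/-- The additive homomorphism to the unit group given by a point of the torus. -/
def toHom (t : AlgTorus M) : M →+ Additive ℂˣ :=
  AddMonoidHom.toMultiplicativeLeft.symm t

@[simp] theorem toHom_apply (t : AlgTorus M) (u : M) : t.toHom u = Additive.ofMul (t.mon u) := rfl

/-- The monomial `x^u` as a character of the torus, with values in `ℂ`. -/
def character (u : M) : AlgTorus M →* ℂ where
  toFun t := t.mon u
  map_one' := by simp
  map_mul' := by simp

@[simp] theorem character_apply (u : M) (t : AlgTorus M) : character u t = t.mon u := rfl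

/-- Evaluation of regular functions at a point of the torus, as an algebra homomorphism. -/
def evalHom (t : AlgTorus M) : AddMonoidAlgebra ℂ M →ₐ[ℂ] ℂ :=
  AddMonoidAlgebra.lift ℂ ℂ M ((Units.coeHom ℂ).comp t)

theorem evalAt_eq_evalHom (t : AlgTorus M) (f : AddMonoidAlgebra ℂ M) :
    t.evalAt f = t.evalHom f := by
  rw [evalHom, AddMonoidAlgebra.lift_apply]
  rfl

@[simp] theorem evalHom_single (t : AlgTorus M) (u : M) (c : ℂ) :
    t.evalHom (AddMonoidAlgebra.single u c) = c * t.mon u := by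
  rw [evalHom, AddMonoidAlgebra.lift_single]
  rfl

theorem isOpen_evalHom_ne_zero (f : AddMonoidAlgebra ℂ M) :
    IsOpen {t : AlgTorus M | t.evalHom f ≠ 0} :=
  TopologicalSpace.isOpen_generateFrom_of_mem ⟨f, by simp only [evalAt_eq_evalHom]⟩

theorem isClosed_evalHom_eq_zero (f : AddMonoidAlgebra ℂ M) :
    IsClosed {t : AlgTorus M | t.evalHom f = 0} := by
  simpa [← isOpen_compl_iff, Set.compl_ofPred] using isOpen_evalHom_ne_zero f

theorem isClosed_mon_eq (u : M) (c : ℂˣ) : IsClosed {t : AlgTorus M | t.mon u = c} := by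
  convert! isClosed_evalHom_eq_zero
    (AddMonoidAlgebra.single u 1 - AddMonoidAlgebra.single (0 : M) (c : ℂ)) using 3
  simp [sub_eq_zero, Units.ext_iff]

theorem isTopologicalBasis : TopologicalSpace.IsTopologicalBasis
    {U : Set (AlgTorus M) | ∃ f : AddMonoidAlgebra ℂ M, U = {t | t.evalHom f ≠ 0}} where
  exists_subset_inter := by
    rintro _ ⟨f, rfl⟩ _ ⟨g, rfl⟩ x ⟨hf, hg⟩
    refine ⟨_, ⟨f * g, rfl⟩, ?_, ?_⟩
    · simpa using ⟨hf, hg⟩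
    · intro t
      simp
  sUnion_eq := Set.eq_univ_of_forall fun t => ⟨_, ⟨1, rfl⟩, by simp⟩
  eq_generateFrom := by
    simp only [← evalAt_eq_evalHom]
    rfl

/-- A proper closed subset is contained in the zero locus of a function that does not vanish at a
given point outside. -/
theorem exists_evalHom_of_notMem {Z : Set (AlgTorus M)} (hZ : IsClosed Z) {t : AlgTorus M}
    (ht : t ∉ Z) : ∃ f : AddMonoidAlgebra ℂ M, t.evalHom f ≠ 0 ∧ ∀ z ∈ Z, z.evalHom f = 0 := by
  obtain ⟨_, ⟨f, rfl⟩, htf, hf⟩ := isTopologicalBasis.exists_subset_of_mem_open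
    (show t ∈ Zᶜ from ht) hZ.isOpen_compl
  exact ⟨f, htf, fun z hz => by_contra fun h => hf h hz⟩

/-- Pullback of regular functions along `s ↦ g * map f s`. -/
def pullback (f : M →+ M') (g : AlgTorus M) : AddMonoidAlgebra ℂ M →ₐ[ℂ] AddMonoidAlgebra ℂ M' :=
  AddMonoidAlgebra.lift ℂ _ M
    { toFun := fun u => AddMonoidAlgebra.single (f u.toAdd) (g.mon u.toAdd : ℂ)
      map_one' := by simp [AddMonoidAlgebra.one_def]
      map_mul' := fun u v => by simp [AddMonoidAlgebra.single_mul_single] }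

theorem evalHom_pullback (f : M →+ M') (g : AlgTorus M) (s : AlgTorus M')
    (F : AddMonoidAlgebra ℂ M) :
    s.evalHom (pullback f g F) = (g * map f s).evalHom F := by
  induction F using AddMonoidAlgebra.induction_linear with
  | zero => simp
  | add a b ha hb => simp [ha, hb]
  | single u c => simp [pullback, AddMonoidAlgebra.lift_single, mul_assoc]

theorem pullback_surjective (f : M →+ M') (hf : Function.Surjective f) (g : AlgTorus M) :
    Function.Surjective (pullback f g) := by
  rw [← AlgHom.range_eq_top, eq_top_iff]
  intro F _
  induction F using AddMonoidAlgebra.induction_linear with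
  | zero => exact zero_mem _
  | add a b ha hb => exact add_mem (ha trivial) (hb trivial)
  | single u c =>
    obtain ⟨u, rfl⟩ := hf u
    exact ⟨AddMonoidAlgebra.single u ((g.mon u : ℂ)⁻¹ * c), by
      simp [pullback, AddMonoidAlgebra.lift_single, AddMonoidAlgebra.smul_single]
      field_simp⟩

/-- As `f` is onto, every regular function on `T_{M'}` is the pullback of one on `T_M`, so both
topologies have the same principal open sets. -/
theorem isInducing_mul_map (f : M →+ M') (hf : Function.Surjective f) (g : AlgTorus M) :
    Topology.IsInducing fun s : AlgTorus M' => g * map f s := by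
  refine ⟨?_⟩
  rw [isTopologicalBasis.eq_generateFrom, isTopologicalBasis.eq_generateFrom,
    induced_generateFrom_eq]
  congr 1
  ext U
  constructor
  · rintro ⟨F, rfl⟩
    obtain ⟨G, rfl⟩ := pullback_surjective f hf g F
    exact ⟨_, ⟨G, rfl⟩, by ext; simp [evalHom_pullback]⟩
  · rintro ⟨_, ⟨G, rfl⟩, rfl⟩
    exact ⟨pullback f g G, by ext; simp [evalHom_pullback]⟩

theorem continuous_map (f : M →+ M') : Continuous (map f) := by
  refine isTopologicalBasis.continuous_iff.2 ?_
  rintro _ ⟨G, rfl⟩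
  convert! isOpen_evalHom_ne_zero (pullback f 1 G) using 1
  ext; simp [evalHom_pullback]

theorem units_zpow_surjective {n : ℤ} (hn : n ≠ 0) : Function.Surjective fun x : ℂˣ => x ^ n := by
  have key : ∀ m : ℕ, m ≠ 0 → ∀ x : ℂˣ, ∃ y : ℂˣ, y ^ m = x := fun m hm x => by
    obtain ⟨z, hz⟩ := IsAlgClosed.exists_pow_nat_eq (x : ℂ) (Nat.pos_of_ne_zero hm)
    have hz0 : z ≠ 0 := by
      rintro rfl
      exact x.ne_zero (by rw [← hz, zero_pow hm])
    exact ⟨Units.mk0 z hz0, Units.ext (by simpa using hz)⟩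
  intro x
  obtain ⟨m, rfl | rfl⟩ := n.eq_nat_or_neg
  · obtain ⟨y, hy⟩ := key m (by simpa using hn) x
    exact ⟨y, by simpa using hy⟩
  · obtain ⟨y, hy⟩ := key m (by simpa using hn) x⁻¹
    exact ⟨y, by simp [hy]⟩

/-- Characters of a subgroup extend, as `ℂˣ` is divisible. -/
theorem map_surjective_of_injective (f : M →+ M') (hf : Function.Injective f) :
    Function.Surjective (map f) := by
  intro t
  let _ : DivisibleBy (Additive ℂˣ) ℤ := divisibleByOfSMulRightSurj _ _ fun {n} hn x => by
    obtain ⟨y, hy⟩ := units_zpow_surjective hn x.toMul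
    exact ⟨Additive.ofMul y, congrArg Additive.ofMul hy⟩
  obtain ⟨h, hh⟩ := (Module.Baer.of_divisible (Additive ℂˣ)).extension_property_addMonoidHom
    f hf t.toHom
  exact ⟨ofHom h, ext fun u => congr(($hh u).toMul)⟩

theorem range_map_mk' (S : AddSubgroup M) :
    Set.range (map (QuotientAddGroup.mk' S)) = {t | ∀ m ∈ S, t.mon m = 1} := by
  ext t
  constructor
  · rintro ⟨s, rfl⟩ m hm
    have : (m : M ⧸ S) = 0 := (QuotientAddGroup.eq_zero_iff m).2 hm
    simp [this]
  · intro h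
    exact ⟨ofHom (QuotientAddGroup.lift S t.toHom fun m hm => by simp [h m hm]), by ext; simp⟩

end AlgTorus

end TorusBasics

/-! ### Irreducibility and Krull dimension of a torus -/

section TorusDimension

variable {M : Type*} [AddCommGroup M] {ι : Type*} (e : Module.Basis ι ℤ M)

namespace AlgTorus

/-- The point of the torus with given coordinates. -/
def ofCoords (c : ι → ℂˣ) : AlgTorus M :=
  ofHom (e.constr ℤ fun i => Additive.ofMul (c i)).toAddMonoidHom

@[simp] theorem ofCoords_mon_basis (c : ι → ℂˣ) (i : ι) : (ofCoords e c).mon (e i) = c i := by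
  simp [ofCoords]

variable {e} in
theorem ext_basis {s t : AlgTorus M} (h : ∀ i, s.mon (e i) = t.mon (e i)) : s = t := by
  have : s.toHom.toIntLinearMap = t.toHom.toIntLinearMap := e.ext fun i => by simp [h]
  exact ext fun u => congr(($this u).toMul)

include e in
theorem character_injective : Function.Injective (character (M := M)) := by
  intro u v huv
  refine e.repr.injective (Finsupp.ext fun i => ?_)
  -- Test at the point whose `i`-th coordinate is `2` and whose other coordinates are `1`.
  have h := DFunLike.congr_fun huv (ofHom ((zmultiplesHom (Additive ℂˣ)
    (Additive.ofMul (Units.mk0 (2 : ℂ) two_ne_zero))).comp (e.coord i).toAddMonoidHom))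
  have h3 : (2 : ℝ) ^ (e.repr u i) = (2 : ℝ) ^ (e.repr v i) := by
    simpa using congrArg norm h
  exact zpow_right_injective₀ (by norm_num) (by norm_num) h3

include e in
-- Distinct characters are linearly independent (Dedekind).
theorem eq_zero_of_evalHom (f : AddMonoidAlgebra ℂ M) (hf : ∀ t : AlgTorus M, t.evalHom f = 0) :
    f = 0 := by
  have hli := (linearIndependent_monoidHom (AlgTorus M) ℂ).comp _ (character_injective e)
  have := linearIndependent_iff.1 hli f.coeff (by
    ext t
    have := hf t
    rw [← evalAt_eq_evalHom] at this
    simpa [Finsupp.linearCombination_apply, Finsupp.sum, evalAt] using this)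
  exact AddMonoidAlgebra.coeff_injective this

include e in
theorem isIrreducible_univ [Finite ι] : IsIrreducible (Set.univ : Set (AlgTorus M)) := by
  -- Torsion-freeness of `M` makes `ℂ[M]` a domain; this is what `mul_ne_zero` needs below.
  have : IsAddTorsionFree M := 
    Function.Injective.isAddTorsionFree e.repr.toAddEquiv.toAddMonoidHom e.repr.injective
  have : Module.Finite ℤ M := Module.Finite.of_basis e
  have : AddMonoid.FG M := AddGroup.fg_iff_addMonoid_fg.1 (Module.Finite.iff_addGroup_fg.1 this)
  refine ⟨⟨1, trivial⟩, ?_⟩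
  rintro U V hU hV ⟨x, -, hx⟩ ⟨y, -, hy⟩
  obtain ⟨_, ⟨f, rfl⟩, hxf, hf⟩ := isTopologicalBasis.exists_subset_of_mem_open hx hU
  obtain ⟨_, ⟨g, rfl⟩, hyg, hg⟩ := isTopologicalBasis.exists_subset_of_mem_open hy hV
  have hf0 : f ≠ 0 := by rintro rfl; simp at hxf
  have hg0 : g ≠ 0 := by rintro rfl; simp at hyg
  by_contra hne
  refine mul_ne_zero hf0 hg0 (eq_zero_of_evalHom e _ fun t => ?_)
  by_contra ht
  rw [map_mul, mul_eq_zero, not_or] at ht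
  exact hne ⟨t, trivial, hf ht.1, hg ht.2⟩

/-- The regular function given by a polynomial in the coordinates. -/
def polyFun : MvPolynomial ι ℂ →ₐ[ℂ] AddMonoidAlgebra ℂ M :=
  MvPolynomial.aeval fun i => AddMonoidAlgebra.single (e i) 1

theorem prod_single_one {κ : Type*} (s : Finset κ) (v : κ → M) :
    ∏ i ∈ s, AddMonoidAlgebra.single (v i) (1 : ℂ) =
      AddMonoidAlgebra.single (∑ i ∈ s, v i) 1 := by
  classical
  induction s using Finset.induction_on with
  | empty => simp [AddMonoidAlgebra.one_def]
  | insert a s ha ih =>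
    rw [Finset.prod_insert ha, Finset.sum_insert ha, ih, AddMonoidAlgebra.single_mul_single,
      one_mul]

/-- Every Laurent polynomial is a polynomial up to a monomial. -/
theorem exists_polyFun [Fintype ι] (f : AddMonoidAlgebra ℂ M) : ∃ (u : M) (F : MvPolynomial ι ℂ),
    AddMonoidAlgebra.single u 1 * f = polyFun e F := by
  classical
  -- A crude bound: the sum of the absolute values of all exponents in `f`.
  obtain ⟨D, hD⟩ : ∃ D : ℕ, ∀ u ∈ f.coeff.support, ∀ i, 0 ≤ e.repr u i + D := by
    refine ⟨∑ u ∈ f.coeff.support, ∑ i, (e.repr u i).natAbs, fun u hu i => ?_⟩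
    have h1 : (e.repr u i).natAbs ≤ ∑ i, (e.repr u i).natAbs :=
      Finset.single_le_sum (f := fun i => (e.repr u i).natAbs) (fun _ _ => Nat.zero_le _)
        (Finset.mem_univ i)
    have h2 := Finset.single_le_sum (f := fun u => ∑ i, (e.repr u i).natAbs)
      (fun _ _ => Nat.zero_le _) hu
    omega
  refine ⟨∑ i, (D : ℤ) • e i, ∑ u ∈ f.coeff.support,
    MvPolynomial.C (f.coeff u) * ∏ i, MvPolynomial.X i ^ (e.repr u i + D).toNat, ?_⟩
  have hf : f = ∑ u ∈ f.coeff.support, AddMonoidAlgebra.single u (f.coeff u) := by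
    rw [← Finsupp.sum, AddMonoidAlgebra.sum_coeff_single]
  conv_lhs => rw [hf]
  rw [Finset.mul_sum, map_sum]
  refine Finset.sum_congr rfl fun u hu => ?_
  rw [AddMonoidAlgebra.single_mul_single, map_mul, map_prod]
  have hC : polyFun e (MvPolynomial.C (f.coeff u)) = AddMonoidAlgebra.single (0 : M) (f.coeff u) :=
    MvPolynomial.aeval_C _ _
  have hX : ∀ i, polyFun e (MvPolynomial.X i ^ (e.repr u i + D).toNat) =
      AddMonoidAlgebra.single ((e.repr u i + D) • e i) 1 := fun i => by
    rw [map_pow, polyFun, MvPolynomial.aeval_X, AddMonoidAlgebra.single_pow, one_pow]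
    conv_rhs => rw [← Int.toNat_of_nonneg (hD u hu i), natCast_zsmul]
  simp_rw [hX]
  rw [hC, prod_single_one, AddMonoidAlgebra.single_mul_single, one_mul, mul_one, zero_add]
  simp_rw [add_smul, Finset.sum_add_distrib, e.sum_repr, add_comm u]

/-- The ideal of polynomials vanishing on a subset of the torus. -/
def vanishing (Z : Set (AlgTorus M)) : Ideal (MvPolynomial ι ℂ) where
  carrier := {F | ∀ z ∈ Z, z.evalHom (polyFun e F) = 0}
  add_mem' ha hb z hz := by simp [ha z hz, hb z hz]
  zero_mem' := by simp
  smul_mem' c F hF z hz := by simp [hF z hz]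

theorem vanishing_isPrime {Z : Set (AlgTorus M)} (hZ : IsIrreducible Z) :
    (vanishing e Z).IsPrime where
  ne_top' h := by
    obtain ⟨z, hz⟩ := hZ.nonempty
    have : (1 : MvPolynomial ι ℂ) ∈ vanishing e Z := h ▸ trivial
    simpa using this z hz
  mem_or_mem' {F G} h := by
    have := isPreirreducible_iff_isClosed_union_isClosed.1 hZ.isPreirreducible _ _
      (isClosed_evalHom_eq_zero (polyFun e F)) (isClosed_evalHom_eq_zero (polyFun e G))
      (fun z hz => by simpa using h z hz)
    exact this

/-- A Laurent polynomial separating `Z` from a point of `Z'` becomes a polynomial after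
multiplication by a monomial, which has no zeros on the torus. -/
theorem vanishing_strictAnti [Fintype ι] {Z Z' : Set (AlgTorus M)} (hZ : IsClosed Z)
    (h : Z ⊂ Z') : vanishing e Z' < vanishing e Z := by
  refine lt_of_le_not_ge (fun F hF z hz => hF z (h.1 hz)) fun hle => ?_
  obtain ⟨t, htZ', htZ⟩ := Set.exists_of_ssubset h
  obtain ⟨f, htf, hf⟩ := exists_evalHom_of_notMem hZ htZ
  obtain ⟨u, F, hF⟩ := exists_polyFun e f
  have : F ∈ vanishing e Z := fun z hz => by rw [← hF, map_mul, hf z hz, mul_zero]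
  have := hle this t htZ'
  rw [← hF, map_mul] at this
  simp [htf] at this

include e in
-- Vanishing ideals turn chains of irreducible closed sets into strictly decreasing chains of primes
-- in a polynomial ring of dimension `|ι|`.
theorem topologicalKrullDim_le [Fintype ι] :
    topologicalKrullDim (AlgTorus M) ≤ Nat.card ι := by
  have : ringKrullDim (MvPolynomial ι ℂ) = Nat.card ι := by simp
  rw [← this, ringKrullDim, ← Order.krullDim_orderDual (α := PrimeSpectrum _)]
  refine Order.krullDim_le_of_strictMono
    (fun Z => OrderDual.toDual ⟨vanishing e (Z : Set (AlgTorus M)), vanishing_isPrime e Z.2⟩)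
    fun Z Z' h => ?_
  exact vanishing_strictAnti e Z.3 h

/-- The subtorus where the first `j` coordinates equal `1`. -/
def coordSubtorus {r : ℕ} (e : Module.Basis (Fin r) ℤ M) (j : ℕ) : Set (AlgTorus M) :=
  {t | ∀ i : Fin r, i < j → t.mon (e i) = 1}

theorem isClosed_coordSubtorus {r : ℕ} (e : Module.Basis (Fin r) ℤ M) (j : ℕ) :
    IsClosed (coordSubtorus e j) := by
  simp only [coordSubtorus, Set.ofPred_forall]
  exact isClosed_iInter fun i => isClosed_iInter fun _ => isClosed_mon_eq _ _

/-- It is the image of the whole torus under the endomorphism dual to the projection `p` that kills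
the first `j` basis vectors. -/
theorem isIrreducible_coordSubtorus {r : ℕ} (e : Module.Basis (Fin r) ℤ M) (j : ℕ) :
    IsIrreducible (coordSubtorus e j) := by
  let p : M →ₗ[ℤ] M := e.constr ℤ fun i => if (i : ℕ) < j then 0 else e i
  have hp : ∀ i, p (e i) = if (i : ℕ) < j then 0 else e i := fun i => e.constr_basis _ _ _
  convert! (isIrreducible_univ e).image (map p.toAddMonoidHom) (continuous_map _).continuousOn
  ext t
  simp only [Set.image_univ, Set.mem_range]
  constructor
  · intro ht
    refine ⟨t, ext_basis (e := e) fun i => ?_⟩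
    by_cases hi : (i : ℕ) < j
    · simp [hp, hi, ht i hi]
    · simp [hp, hi]
  · rintro ⟨s, rfl⟩ i hi
    simp [hp, hi]

theorem coordSubtorus_ssubset {r : ℕ} (e : Module.Basis (Fin r) ℤ M) {j k : ℕ} (hjk : j < k)
    (hj : j < r) : coordSubtorus e k ⊂ coordSubtorus e j := by
  refine ⟨fun t ht i hi => ht i (hi.trans hjk), fun h => ?_⟩
  have := h (a := ofCoords e fun i => if (i : ℕ) < j then 1 else -1) (fun i hi => by simp [hi])
    ⟨j, hj⟩ hjk
  simp [Units.ext_iff] at this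
  norm_num at this

theorem le_topologicalKrullDim {r : ℕ} (e : Module.Basis (Fin r) ℤ M) :
    r ≤ topologicalKrullDim (AlgTorus M) := by
  let p : LTSeries (TopologicalSpace.IrreducibleCloseds (AlgTorus M)) :=
    { length := r
      -- The index `r - i` makes the chain increase, from the point `1` up to the whole torus.
      toFun := fun i => ⟨coordSubtorus e (r - i), isIrreducible_coordSubtorus e _,
        isClosed_coordSubtorus e _⟩
      step := fun i => coordSubtorus_ssubset e (j := r - (i.succ : ℕ)) (k := r - (i.castSucc : ℕ))
        (by have := i.2; simp only [Fin.val_succ, Fin.val_castSucc]; omega)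
        (by have := i.2; simp only [Fin.val_succ]; omega) }
  exact Order.LTSeries.length_le_krullDim p

theorem topologicalKrullDim_eq {r : ℕ} (e : Module.Basis (Fin r) ℤ M) :
    topologicalKrullDim (AlgTorus M) = r :=
  le_antisymm (by simpa using topologicalKrullDim_le e) (le_topologicalKrullDim e)

end AlgTorus

end TorusDimension

/-! ### Zariski closure under linear embeddings -/

section ProjectiveMaps

variable {V W : Type*} [AddCommGroup V] [Module ℂ V] [AddCommGroup W] [Module ℂ W]

theorem eval_linearForms_smul {F : MvPolynomial (Module.Dual ℂ V) ℂ} {d : ℕ}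
    (hF : F.IsHomogeneous d) (a : ℂ) (v : V) :
    MvPolynomial.eval (fun l : Module.Dual ℂ V => l (a • v)) F =
      a ^ d * MvPolynomial.eval (fun l : Module.Dual ℂ V => l v) F := by
  rw [MvPolynomial.eval_eq, MvPolynomial.eval_eq, Finset.mul_sum]
  refine Finset.sum_congr rfl fun m hm => ?_
  have hd : ∑ i ∈ m.support, m i = d := by
    rw [← hF (MvPolynomial.mem_support_iff.1 hm), Finsupp.weight_apply, Finsupp.sum]
    simp
  simp only [map_smul, smul_eq_mul, mul_pow, Finset.prod_mul_distrib, Finset.prod_pow_eq_pow_sum,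
    hd]
  ring

theorem vanishesAt_mk {F : MvPolynomial (Module.Dual ℂ V) ℂ} {d : ℕ} (hF : F.IsHomogeneous d)
    (v : V) (hv : v ≠ 0) : VanishesAt F (Projectivization.mk ℂ v hv) ↔
      MvPolynomial.eval (fun l : Module.Dual ℂ V => l v) F = 0 := by
  obtain ⟨a, ha⟩ := Projectivization.exists_smul_eq_mk_rep ℂ v hv
  rw [VanishesAt, ← ha, Units.smul_def, eval_linearForms_smul hF]
  simp

theorem vanishesAt_map {F : MvPolynomial (Module.Dual ℂ W) ℂ} {d : ℕ} (hF : F.IsHomogeneous d)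
    (f : V →ₗ[ℂ] W) (hf : Function.Injective f) (p : ℙ ℂ V) :
    VanishesAt F (Projectivization.map f hf p) ↔
      VanishesAt (MvPolynomial.rename (fun l : Module.Dual ℂ W => l.comp f) F) p := by
  induction p using Projectivization.ind with
  | h v hv =>
    rw [Projectivization.map_mk, vanishesAt_mk hF, vanishesAt_mk hF.rename_isHomogeneous,
      MvPolynomial.eval_rename]
    rfl

/-- Equations are pulled back along `f` in one direction and along a linear left inverse `g` in the
other, since a linear subspace is closed. -/
theorem image_map_zariskiClosure (f : V →ₗ[ℂ] W) (hf : Function.Injective f) (S : Set (ℙ ℂ V)) :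
    Projectivization.map f hf '' zariskiClosure S =
      zariskiClosure (Projectivization.map f hf '' S) := by
  apply Set.Subset.antisymm
  · rintro _ ⟨p, hp, rfl⟩ F d hF hFS
    rw [vanishesAt_map hF]
    exact hp _ d hF.rename_isHomogeneous fun s hs =>
      (vanishesAt_map hF f hf s).1 (hFS _ ⟨s, hs, rfl⟩)
  · intro p hp
    obtain ⟨g, hg⟩ := f.exists_leftInverse_of_injective (LinearMap.ker_eq_bot.2 hf)
    have hgf : ∀ v, g (f v) = v := fun v => congr($hg v)
    induction p using Projectivization.ind with
    | h w hw =>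
      -- The linear forms `l ∘ (f ∘ g - id)` vanish on the image of `f`, hence at `w`.
      have hwf : f (g w) = w := by
        by_contra hne
        obtain ⟨l, hl⟩ : ∃ l : Module.Dual ℂ W, l (f (g w) - w) ≠ 0 := by
          by_contra! h
          exact hne (sub_eq_zero.1 ((Module.forall_dual_apply_eq_zero_iff ℂ _).1 h))
        have hlin := hp (MvPolynomial.X (l.comp (f.comp g - LinearMap.id))) 1
          (MvPolynomial.isHomogeneous_X _ _) ?_
        · rw [vanishesAt_mk (MvPolynomial.isHomogeneous_X _ _)] at hlin
          exact hl (by simpa using hlin)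
        · rintro _ ⟨s, -, rfl⟩
          rw [vanishesAt_map (MvPolynomial.isHomogeneous_X _ _)]
          simp [VanishesAt, hgf]
      have hgw : g w ≠ 0 := by
        intro h
        rw [h, map_zero] at hwf
        exact hw hwf.symm
      refine ⟨Projectivization.mk ℂ (g w) hgw, fun F d hF hFS => ?_, ?_⟩
      · have := hp (MvPolynomial.rename (fun l : Module.Dual ℂ V => l.comp g) F) d
          hF.rename_isHomogeneous ?_
        · rw [vanishesAt_mk hF.rename_isHomogeneous, MvPolynomial.eval_rename] at this
          rw [vanishesAt_mk hF]
          exact this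
        · rintro _ ⟨s, hs, rfl⟩
          rw [vanishesAt_map hF.rename_isHomogeneous, MvPolynomial.rename_rename]
          have hid : (fun l : Module.Dual ℂ W => l.comp f) ∘ (fun l : Module.Dual ℂ V => l.comp g) =
              id := by
            ext l v
            simp [hgf]
          rw [hid, MvPolynomial.rename_id, AlgHom.id_apply]
          exact hFS s hs
      · simp only [Projectivization.map_mk, hwf]

/-- A linear embedding yields a projective equivalence. -/
theorem projEquiv_of_image_eq [Module.Finite ℂ W] [Nontrivial W] (f : V →ₗ[ℂ] W)
    (hf : Function.Injective f) {X : Set (ℙ ℂ V)} {Y : Set (ℙ ℂ W)}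
    (h : Projectivization.map f hf '' X = Y) : ProjEquiv Y X := by
  obtain ⟨N, hN⟩ := Nat.exists_eq_succ_of_ne_zero (Module.finrank_pos (R := ℂ) (M := W)).ne'
  let e : W ≃ₗ[ℂ] (Fin (N + 1) → ℂ) := (Module.finBasisOfFinrankEq ℂ W hN).equivFun
  refine ⟨N, e.toLinearMap, e.toLinearMap.comp f, e.injective, e.injective.comp hf, ?_⟩
  rw [← h, ← Set.image_comp]
  congr 1
  ext p
  induction p using Projectivization.ind with
  | h v hv => rfl

end ProjectiveMaps

/-! ### The torus of `X_B` and restriction to cosets -/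

section ToricVarieties

variable {M : Type*} [AddCommGroup M]

theorem toricVariety_eq (A : Finset M) (hA : A.Nonempty) :
    toricVariety A = zariskiClosure (Set.range (toricMap A hA)) := by
  rw [toricVariety]
  congr 1
  ext p
  constructor
  · rintro ⟨_, t, rfl⟩
    exact ⟨t, rfl⟩
  · rintro ⟨t, rfl⟩
    exact ⟨hA, t, rfl⟩

theorem toricMap_eq_iff (A : Finset M) (hA : A.Nonempty) (s t : AlgTorus M) :
    toricMap A hA s = toricMap A hA t ↔ ∃ a : ℂˣ, ∀ u ∈ A, s.mon u = a * t.mon u := by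
  rw [toricMap, toricMap, Projectivization.mk_eq_mk_iff]
  refine exists_congr fun a => ?_
  rw [eq_comm, funext_iff]
  simp [Units.ext_iff, Units.smul_def]

theorem torusInclusion_map (B : Finset M) (u₀ : M) (h₀ : u₀ ∈ B) (t : AlgTorus M) :
    torusInclusion B u₀ h₀ (AlgTorus.map (diffLattice B).subtype t) = toricMap B ⟨u₀, h₀⟩ t := by
  refine (Projectivization.mk_eq_mk_iff ℂ _ _ _ _).2 ⟨(t.mon u₀)⁻¹, funext fun u => ?_⟩
  simp [Units.smul_def, div_eq_inv_mul]

/-- The coordinate at `u₀` is `1` and fixes the projective scalar, so the characters agree on all `u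
- u₀`, which generate `⟨B - B⟩`. -/
theorem torusInclusion_injective (B : Finset M) (u₀ : M) (h₀ : u₀ ∈ B) :
    Function.Injective (torusInclusion B u₀ h₀) := by
  intro s t h
  rw [torusInclusion, torusInclusion, Projectivization.mk_eq_mk_iff] at h
  obtain ⟨a, ha⟩ := h
  have key : ∀ u (hu : u ∈ B), (a : ℂ) * t.mon ⟨u - u₀, sub_mem_diffLattice hu h₀⟩ =
      s.mon ⟨u - u₀, sub_mem_diffLattice hu h₀⟩ := fun u hu => congrFun ha ⟨u, hu⟩
  have ha1 : (a : ℂ) = 1 := by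
    have h0 : (⟨u₀ - u₀, sub_mem_diffLattice h₀ h₀⟩ : diffLattice B) = 0 :=
      Subtype.ext (sub_self u₀)
    simpa only [h0, AlgTorus.mon_zero, Units.val_one, mul_one] using key u₀ h₀
  refine AlgTorus.ext fun ⟨m, hm⟩ => ?_
  induction hm using AddSubgroup.closure_induction with
  | mem m hm =>
    obtain ⟨u, hu, v, hv, rfl⟩ := hm
    have huv : (⟨u - v, sub_mem_diffLattice hu hv⟩ : diffLattice B) =
        ⟨u - u₀, sub_mem_diffLattice hu h₀⟩ - ⟨v - u₀, sub_mem_diffLattice hv h₀⟩ :=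
      Subtype.ext (by simp)
    have h1 := key u hu
    have h2 := key v hv
    rw [ha1, one_mul, Units.val_inj] at h1 h2
    change s.mon ⟨u - v, sub_mem_diffLattice hu hv⟩ = t.mon ⟨u - v, sub_mem_diffLattice hu hv⟩
    rw [huv, AlgTorus.mon_sub, AlgTorus.mon_sub, h1, h2]
  | zero => exact s.mon_zero.trans t.mon_zero.symm
  | add x y hx hy ihx ihy =>
    have := congrArg₂ (· * ·) ihx ihy
    simp only [← AlgTorus.mon_add] at this
    exact this
  | neg x hx ih =>
    have := congrArg (·⁻¹) ih
    simp only [← AlgTorus.mon_neg] at this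
    exact this

/-- Two points of the torus have the same image in `X_B` if and only if they agree on
`⟨B - B⟩`. -/
theorem toricMap_eq_iff_diffLattice (B : Finset M) (hB : B.Nonempty) (s t : AlgTorus M) :
    toricMap B hB s = toricMap B hB t ↔ ∀ m ∈ diffLattice B, s.mon m = t.mon m := by
  obtain ⟨u₀, h₀⟩ := id hB
  rw [← torusInclusion_map B u₀ h₀, ← torusInclusion_map B u₀ h₀,
    (torusInclusion_injective B u₀ h₀).eq_iff]
  constructor
  · intro h m hm
    exact congr(AlgTorus.mon $h ⟨m, hm⟩)
  · intro h
    exact AlgTorus.ext fun m => h m m.2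

/-- The closure of the image of a translate of a subtorus is projectively equivalent to the toric
variety of the projected set of exponents. -/
theorem projEquiv_toricVariety_projSet (A : Finset M) (hA : A.Nonempty) (S : AddSubgroup M)
    (g : AlgTorus M) :
    ProjEquiv (zariskiClosure (toricMap A hA ''
        Set.range fun s => g * AlgTorus.map (QuotientAddGroup.mk' S) s))
      (toricVariety (projSet S A)) := by
  classical
  have hmem : ∀ u : A, QuotientAddGroup.mk' S (u : M) ∈ projSet S A := fun u =>
    by
      rw [projSet, Finset.mem_image]
      exact ⟨u, u.2, rfl⟩
  have hne : (projSet S A).Nonempty := ⟨_, hmem ⟨_, hA.choose_spec⟩⟩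
  have : Nonempty A := hA.to_subtype
  -- The `u`-coordinate on the coset is the coordinate at the class of `u`, scaled by `g(u)`.
  let f : (projSet S A → ℂ) →ₗ[ℂ] (A → ℂ) := LinearMap.pi fun u =>
    (g.mon (u : M) : ℂ) • LinearMap.proj ⟨_, hmem u⟩
  have hf : Function.Injective f := by
    intro y z hyz
    ext ⟨w, hw⟩
    obtain ⟨u, hu, rfl⟩ := Finset.mem_image.1 (by rwa [projSet] at hw)
    simpa [f] using congrFun hyz ⟨u, hu⟩
  refine projEquiv_of_image_eq f hf ?_
  rw [toricVariety_eq _ hne, image_map_zariskiClosure, ← Set.range_comp, ← Set.range_comp]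
  congr 2

end ToricVarieties

/-! ### Counting multi-indices -/

section MultiIndices

/-- A multi-index of order at most `k` in `n` variables is a composition of `k` into `n + 1`
parts. -/
def multiIndexEquiv (n k : ℕ) : MultiIndex n k ≃ {P : Fin (n + 1) → ℕ // ∑ i, P i = k} where
  toFun α := ⟨Fin.cons (k - ∑ i, α.1 i) α.1, by
    rw [Fin.sum_cons]
    exact Nat.sub_add_cancel α.2⟩
  invFun P := ⟨Fin.tail P.1, by
    have := P.2
    rw [Fin.sum_univ_succ] at this
    simp only [Fin.tail]
    omega⟩
  left_inv α := Subtype.ext (by simp)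
  right_inv P := by
    have := P.2
    rw [Fin.sum_univ_succ] at this
    refine Subtype.ext (funext fun i => ?_)
    refine Fin.cases ?_ (fun i => ?_) i
    · simp only [Fin.tail, Fin.cons_zero]
      omega
    · simp [Fin.tail]

instance (n k : ℕ) : Finite (MultiIndex n k) :=
  Finite.of_equiv _ ((multiIndexEquiv n k).trans
    (Sym.equivNatSumOfFintype (Fin (n + 1)) k).symm).symm

theorem card_multiIndex (n k : ℕ) : Nat.card (MultiIndex n k) = (n + k).choose k := by
  rw [Nat.card_congr ((multiIndexEquiv n k).trans
    (Sym.equivNatSumOfFintype (Fin (n + 1)) k).symm), Nat.card_eq_fintype_card,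
    Sym.card_sym_eq_choose, Fintype.card_fin]
  congr 1
  omega

/-- An enumeration of the multi-indices. -/
def multiIndexEnum (n k : ℕ) : Fin ((n + k).choose k) ≃ MultiIndex n k :=
  (Finite.equivFinOfCardEq (card_multiIndex n k)).symm

end MultiIndices

/-! ### Derivatives of Laurent monomials -/

section Derivatives

variable {M : Type*} [AddCommGroup M] {n : ℕ} (b : Module.Basis (Fin n) ℤ M)

/-- This holds on all of `ℂⁿ`: where `z i = 0` and the exponent is negative, both sides take the
default value `0`. As an identity of functions it can be iterated. -/
theorem partialDeriv_const_mul_monomialFun (i : Fin n) (c : ℂ) (u : M) :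
    partialDeriv i (fun z => c * monomialFun b u z) =
      fun z => c * (b.repr u i) * monomialFun b (u - b i) z := by
  funext z
  have h1 : ∀ s : ℂ, c * monomialFun b u (z + s • Pi.single i 1) =
      (c * ∏ j ∈ Finset.univ.erase i, z j ^ (b.repr u j)) * (z i + s) ^ (b.repr u i) := fun s => by
    rw [monomialFun, ← Finset.prod_erase_mul _ _ (Finset.mem_univ i), ← mul_assoc]
    congr 2
    · refine Finset.prod_congr rfl fun j hj => ?_
      simp [Finset.ne_of_mem_erase hj]
    · simp
  have h2 : monomialFun b (u - b i) z =
      (∏ j ∈ Finset.univ.erase i, z j ^ (b.repr u j)) * z i ^ (b.repr u i - 1) := by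
    rw [monomialFun, ← Finset.prod_erase_mul _ _ (Finset.mem_univ i)]
    congr 1
    · refine Finset.prod_congr rfl fun j hj => ?_
      simp [(Finset.ne_of_mem_erase hj).symm]
    · simp
  rw [partialDeriv, lineDeriv]
  simp_rw [h1]
  rw [deriv_const_mul_field, deriv_comp_const_add (f := fun x : ℂ => x ^ (b.repr u i)), deriv_zpow,
    h2, add_zero]
  ring

theorem iterate_partialDeriv_monomialFun (i : Fin n) (a : ℕ) (c : ℂ) (u : M) :
    ∃ c' : ℂ, (partialDeriv i)^[a] (fun z => c * monomialFun b u z) =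
      fun z => c' * monomialFun b (u - a • b i) z := by
  induction a with
  | zero => exact ⟨c, by simp⟩
  | succ a ih =>
    obtain ⟨c', hc'⟩ := ih
    refine ⟨c' * b.repr (u - a • b i) i, ?_⟩
    rw [Function.iterate_succ_apply', hc', partialDeriv_const_mul_monomialFun, sub_sub, succ_nsmul]

theorem exists_mixedDeriv_monomialFun (α : Fin n → ℕ) (u : M) :
    ∃ c : ℂ, mixedDeriv α (monomialFun b u) =
      fun z => c * monomialFun b (u - ∑ i, α i • b i) z := by
  rw [mixedDeriv, Fin.sum_univ_def]
  induction List.finRange n with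
  | nil => exact ⟨1, by simp⟩
  | cons i l ih =>
    obtain ⟨c, hc⟩ := ih
    obtain ⟨c', hc'⟩ := iterate_partialDeriv_monomialFun b i (α i) c
      (u - (l.map fun i => α i • b i).sum)
    refine ⟨c', ?_⟩
    rw [List.foldr_cons, hc, hc', List.map_cons, List.sum_cons, sub_sub, add_comm]

@[simp] theorem monomialFun_coords (u : M) (t : AlgTorus M) :
    monomialFun b u (coords b t) = t.mon u := by
  conv_rhs => rw [← b.sum_repr u, AlgTorus.mon_sum]
  simp [monomialFun, coords]

/-- The constant produced by differentiation does not depend on the point, so it can be read off at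
`1`. -/
theorem mixedDeriv_monomialFun_coords (α : Fin n → ℕ) (u : M) (t : AlgTorus M) :
    mixedDeriv α (monomialFun b u) (coords b t) =
      (t.mon (∑ i, α i • b i))⁻¹ * (t.mon u * mixedDeriv α (monomialFun b u) (coords b 1)) := by
  obtain ⟨c, hc⟩ := exists_mixedDeriv_monomialFun b α u
  simp [hc]
  field_simp

end Derivatives

/-! ### Equivariance of osculating spaces -/

section TorusAction

variable {M : Type*} [AddCommGroup M]

/-- The diagonal action of the torus on `ℂ^A`. -/
def diagAction (A : Finset M) (t : AlgTorus M) : (A → ℂ) →ₗ[ℂ] (A → ℂ) :=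
  LinearMap.pi fun u => (t.mon (u : M) : ℂ) • LinearMap.proj u

@[simp] theorem diagAction_apply (A : Finset M) (t : AlgTorus M) (x : A → ℂ) (u : A) :
    diagAction A t x u = t.mon (u : M) * x u := rfl

theorem diagAction_injective (A : Finset M) (t : AlgTorus M) :
    Function.Injective (diagAction A t) := by
  intro x y h
  ext u
  simpa using congrFun h u

variable {n : ℕ} (b : Module.Basis (Fin n) ℤ M) (A : Finset M) (k : ℕ)

theorem jetMatrix_row (t : AlgTorus M) (α : MultiIndex n k) :
    jetMatrix b A k t α =
      (t.mon (∑ i, α.1 i • b i))⁻¹ • diagAction A t (jetMatrix b A k 1 α) := by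
  ext u
  simp [jetMatrix, mixedDeriv_monomialFun_coords b α.1 u.1 t, Units.smul_def]

/-- The nonzero scalars on the rows in `jetMatrix_row` do not change the row space. -/
theorem gaussMap_eq_map (t : AlgTorus M) :
    gaussMap b A k t = (gaussMap b A k 1).map (diagAction A t) := by
  rw [gaussMap, gaussMap, Submodule.map_span, ← Set.range_comp]
  apply le_antisymm <;> rw [Submodule.span_le] <;> rintro _ ⟨α, rfl⟩
  · dsimp only
    rw [jetMatrix_row, Units.smul_def]
    exact Submodule.smul_mem _ _ (Submodule.subset_span ⟨α, rfl⟩)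
  · have h : (diagAction A t ∘ fun α => jetMatrix b A k 1 α) α =
        (t.mon (∑ i, α.1 i • b i) : ℂ) • jetMatrix b A k t α := by
      rw [jetMatrix_row, Units.smul_def, smul_smul]
      simp
    rw [h]
    exact Submodule.smul_mem _ _ (Submodule.subset_span ⟨α, rfl⟩)

theorem finrank_gaussMap_eq_one (t : AlgTorus M) :
    Module.finrank ℂ (gaussMap b A k t) = Module.finrank ℂ (gaussMap b A k 1) := by
  rw [gaussMap_eq_map]
  exact (Submodule.equivMapOfInjective _ (diagAction_injective A t) _).finrank_eq.symm

variable {b A k}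

/-- By equivariance the rank is the same at all points, so the maximal rank is attained everywhere.
-/
theorem finrank_gaussMap (hk : GenericallyJetSpanned b A k) (t : AlgTorus M) :
    Module.finrank ℂ (gaussMap b A k t) = (n + k).choose k := by
  rw [← hk, generalOscDim]
  have : ∀ s, (jetMatrix b A k s).rank = Module.finrank ℂ (gaussMap b A k t) := fun s => by
    rw [Matrix.rank_eq_finrank_span_row, finrank_gaussMap_eq_one b A k t,
      ← finrank_gaussMap_eq_one b A k s]
    rfl
  simp [this]

theorem gaussMap_eq_of_toricMap_eq (hA : A.Nonempty) (s t : AlgTorus M)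
    (h : toricMap A hA s = toricMap A hA t) : gaussMap b A k s = gaussMap b A k t := by
  obtain ⟨a, ha⟩ := (toricMap_eq_iff A hA s t).1 h
  have : diagAction A s = (a : ℂ) • diagAction A t := by
    ext x u
    simp [ha u u.2, mul_assoc]
  rw [gaussMap_eq_map b A k s, gaussMap_eq_map b A k t, this, Submodule.map_smul _ _ _ a.ne_zero]

end TorusAction

/-! ### Injectivity of the Plücker embedding -/

section PluckerLine

variable {V : Type*} [AddCommGroup V] [Module ℂ V] {q : ℕ}

theorem ιMulti_mem_span_of_mem_span (w v : Fin q → V)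
    (hv : ∀ i, v i ∈ Submodule.span ℂ (Set.range w)) :
    exteriorPower.ιMulti ℂ q v ∈ Submodule.span ℂ {exteriorPower.ιMulti ℂ q w} := by
  let e := Pi.basisFun ℂ (Fin q)
  let g : (Fin q → ℂ) →ₗ[ℂ] V := e.constr ℂ w
  have hge : ∀ i, g (e i) = w i := fun i => e.constr_basis _ _ _
  have hg : ∀ i, ∃ c, g c = v i := fun i => by
    have : LinearMap.range g = Submodule.span ℂ (Set.range w) := e.constr_range ℂ
    rw [← LinearMap.mem_range, this]
    exact hv i
  choose c hc using hg
  -- An alternating `q`-form on `ℂ^q` is its value on the basis times the determinant.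
  have key : (exteriorPower.ιMulti ℂ q).compLinearMap g =
      (LinearMap.toSpanSingleton ℂ _ (exteriorPower.ιMulti ℂ q w)).compAlternatingMap e.det := by
    refine Module.Basis.ext_alternating e fun i h => ?_
    let σ : Equiv.Perm (Fin q) := Equiv.ofBijective i (Finite.injective_iff_bijective.1 h)
    change exteriorPower.ιMulti ℂ q (fun j => g (e (σ j))) =
      e.det (e ∘ σ) • exteriorPower.ιMulti ℂ q w
    simp only [hge]
    rw [AlternatingMap.map_perm, Module.Basis.det_self]
    change exteriorPower.ιMulti ℂ q (w ∘ σ) = _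
    rw [AlternatingMap.map_perm]
    rcases Int.units_eq_one_or (Equiv.Perm.sign σ) with hσ | hσ
    · simp [hσ]
    · simp only [hσ, Units.neg_smul, one_smul]
      exact (neg_one_smul ℂ _).symm
  have h := congr($key c)
  simp only [AlternatingMap.compLinearMap_apply, hc] at h
  rw [h]
  exact Submodule.smul_mem _ _ (Submodule.mem_span_singleton_self _)

theorem pluckerLine_span (w : Fin q → V) :
    pluckerLine q (Submodule.span ℂ (Set.range w)) =
      Submodule.span ℂ {exteriorPower.ιMulti ℂ q w} := by
  apply le_antisymm
  · rw [pluckerLine, Submodule.span_le]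
    rintro _ ⟨v, hv, rfl⟩
    exact ιMulti_mem_span_of_mem_span w v hv
  · rw [Submodule.span_singleton_le_iff_mem]
    exact Submodule.subset_span ⟨w, fun i => Submodule.subset_span ⟨i, rfl⟩, rfl⟩

theorem ιMulti_ne_zero_of_linearIndependent {v : Fin q → V} (hv : LinearIndependent ℂ v) :
    exteriorPower.ιMulti ℂ q v ≠ 0 := by
  have := (exteriorPower.ιMulti_family_linearIndependent_field (n := q) hv).ne_zero
    (Set.powersetCard.ofFinEmbEquiv (RelEmbedding.refl _))
  simpa [exteriorPower.ιMulti_family] using this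

/-- This recovers a subspace from its Plücker vector `ω`, as the set of `v` with `v ∧ ω = 0`. -/
theorem mem_span_iff_ιMulti_cons {w : Fin q → V} (hw : LinearIndependent ℂ w) (v : V) :
    v ∈ Submodule.span ℂ (Set.range w) ↔
      ExteriorAlgebra.ι ℂ v * ExteriorAlgebra.ιMulti ℂ q w = 0 := by
  have h : ExteriorAlgebra.ι ℂ v * ExteriorAlgebra.ιMulti ℂ q w =
      (exteriorPower.ιMulti ℂ (q + 1) (Fin.cons v w : Fin (q + 1) → V) : ExteriorAlgebra ℂ V) := by
    rw [exteriorPower.ιMulti_apply_coe, ExteriorAlgebra.ιMulti_succ_apply]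
    rfl
  rw [h, ZeroMemClass.coe_eq_zero]
  constructor
  · intro hv
    refine AlternatingMap.map_linearDependent _ _ fun hli => ?_
    exact (linearIndependent_finCons.1 hli).2 hv
  · intro h0
    by_contra hv
    exact ιMulti_ne_zero_of_linearIndependent (linearIndependent_finCons.2 ⟨hw, hv⟩) h0

theorem span_le_span_of_ιMulti {w w' : Fin q → V} (hw : LinearIndependent ℂ w)
    (hw' : LinearIndependent ℂ w')
    (h : exteriorPower.ιMulti ℂ q w ∈ Submodule.span ℂ {exteriorPower.ιMulti ℂ q w'}) :
    Submodule.span ℂ (Set.range w') ≤ Submodule.span ℂ (Set.range w) := by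
  intro v hv
  rw [mem_span_iff_ιMulti_cons hw]
  rw [mem_span_iff_ιMulti_cons hw'] at hv
  obtain ⟨c, hc⟩ := Submodule.mem_span_singleton.1 h
  have hc' := congrArg (Subtype.val) hc
  rw [Submodule.coe_smul, exteriorPower.ιMulti_apply_coe, exteriorPower.ιMulti_apply_coe] at hc'
  rw [← hc', mul_smul_comm, hv, smul_zero]

/-- The Plücker embedding is injective. -/
theorem pluckerLine_inj [Module.Finite ℂ V] {W W' : Submodule ℂ V}
    (hW : Module.finrank ℂ W = q) (hW' : Module.finrank ℂ W' = q) :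
    pluckerLine q W = pluckerLine q W' ↔ W = W' := by
  refine ⟨fun h => ?_, fun h => h ▸ rfl⟩
  have key : ∀ U : Submodule ℂ V, Module.finrank ℂ U = q → ∃ w : Fin q → V,
      LinearIndependent ℂ w ∧ Submodule.span ℂ (Set.range w) = U := fun U hU => by
    let e := Module.finBasisOfFinrankEq ℂ U hU
    refine ⟨fun i => e i, e.linearIndependent.map' U.subtype (Submodule.ker_subtype _), ?_⟩
    rw [show (fun i => (e i : V)) = U.subtype ∘ e from rfl, Set.range_comp, ← Submodule.map_span,
      e.span_eq, Submodule.map_subtype_top]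
  obtain ⟨w, hw, rfl⟩ := key W hW
  obtain ⟨w', hw', rfl⟩ := key W' hW'
  rw [pluckerLine_span, pluckerLine_span] at h
  apply le_antisymm
  · exact span_le_span_of_ιMulti hw' hw (h ▸ Submodule.mem_span_singleton_self _)
  · exact span_le_span_of_ιMulti hw hw' (h ▸ Submodule.mem_span_singleton_self _)

end PluckerLine

/-! ### Weights of the torus on the exterior power -/

section PluckerCoordinates

variable {M : Type*} [AddCommGroup M] (A : Finset M) [LinearOrder A] (q : ℕ)

/-- The standard basis of `⋀^q ℂ^A`. -/
def extBasis : Module.Basis (Set.powersetCard A q) ℂ (⋀[ℂ]^q (A → ℂ)) :=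
  (Pi.basisFun ℂ A).exteriorPower q

variable {A q}

/-- The weight of a vector of the standard basis of `⋀^q ℂ^A`. -/
def extWeight (s : Set.powersetCard A q) : M := ∑ u ∈ s.1, (u : M)

theorem map_diagAction_extBasis (t : AlgTorus M) (s : Set.powersetCard A q) :
    exteriorPower.map q (diagAction A t) (extBasis A q s) =
      (t.mon (extWeight s) : ℂ) • extBasis A q s := by
  have h1 : diagAction A t ∘ Pi.basisFun ℂ A =
      fun u : A => (t.mon (u : M) : ℂ) • Pi.basisFun ℂ A u := by
    ext u v
    by_cases h : v = u
    · subst h; simp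
    · simp [h]
  rw [extBasis, exteriorPower.basis_apply, exteriorPower.map_apply_ιMulti_family, h1,
    exteriorPower.ιMulti_family, exteriorPower.ιMulti_family]
  have h2 : ∏ i, (t.mon (Set.powersetCard.ofFinEmbEquiv.symm s i : M) : ℂ) =
      t.mon (extWeight s) := by
    rw [extWeight, AlgTorus.mon_sum, Units.coe_prod]
    -- The product over `Fin q` runs through `s` by its increasing enumeration.
    have hs : s.1 = Finset.univ.map (Set.powersetCard.ofFinEmbEquiv.symm s).toEmbedding := by
      ext i
      rw [Set.powersetCard.mem_coe_iff,
        ← Set.powersetCard.mem_range_ofFinEmbEquiv_symm_iff_mem s i]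
      simp
    conv_rhs => rw [hs, Finset.prod_map]
    rfl
  rw [← h2]
  exact (exteriorPower.ιMulti ℂ q).toMultilinearMap.map_smul_univ _ _

theorem extBasis_repr_map_diagAction (t : AlgTorus M) (ω : ⋀[ℂ]^q (A → ℂ))
    (s : Set.powersetCard A q) :
    (extBasis A q).repr (exteriorPower.map q (diagAction A t) ω) s =
      t.mon (extWeight s) * (extBasis A q).repr ω s := by
  have : (extBasis A q).coord s ∘ₗ exteriorPower.map q (diagAction A t) =
      (t.mon (extWeight s) : ℂ) • (extBasis A q).coord s := by
    refine (extBasis A q).ext fun s' => ?_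
    rw [LinearMap.comp_apply, map_diagAction_extBasis]
    by_cases h : s' = s
    · subst h; simp
    · simp [h]
  exact congr($this ω)

end PluckerCoordinates

/-! ### Plücker coordinates of osculating spaces -/

section PluckerOfGauss

variable {M : Type*} [AddCommGroup M] {n : ℕ} (b : Module.Basis (Fin n) ℤ M) (A : Finset M) (k : ℕ)

/-- The Plücker vector of the osculating space at `(1, …, 1)`. -/
def jetPlucker : ⋀[ℂ]^((n + k).choose k) (A → ℂ) :=
  exteriorPower.ιMulti ℂ _ fun i => jetMatrix b A k 1 (multiIndexEnum n k i)

theorem pluckerLine_gaussMap (t : AlgTorus M) :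
    pluckerLine ((n + k).choose k) (gaussMap b A k t) =
      Submodule.span ℂ {exteriorPower.map _ (diagAction A t) (jetPlucker b A k)} := by
  have h : gaussMap b A k t = Submodule.span ℂ
      (Set.range (diagAction A t ∘ fun i => jetMatrix b A k 1 (multiIndexEnum n k i))) := by
    rw [gaussMap_eq_map, gaussMap, Submodule.map_span, Set.range_comp]
    congr 2
    exact ((multiIndexEnum n k).surjective.range_comp _).symm
  rw [h, pluckerLine_span, jetPlucker, exteriorPower.map_apply_ιMulti]

variable {b A k} in
theorem jetPlucker_ne_zero (hk : GenericallyJetSpanned b A k) : jetPlucker b A k ≠ 0 := by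
  refine ιMulti_ne_zero_of_linearIndependent ?_
  rw [linearIndependent_iff_card_eq_finrank_span, Fintype.card_fin, Set.finrank]
  have h : Set.range (fun i => jetMatrix b A k 1 (multiIndexEnum n k i)) =
      Set.range fun α => jetMatrix b A k 1 α := (multiIndexEnum n k).surjective.range_comp _
  rw [h]
  exact (finrank_gaussMap hk 1).symm

theorem nonsingularJets_iff (S : Finset M) (c : Fin ((n + k).choose k) ≃ S) :
    NonsingularJets b S k ↔
      ((jetMatrix b S k 1).submatrix (multiIndexEnum n k) c).det ≠ 0 := by
  refine ⟨?_, fun h => ⟨_, c, h⟩⟩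
  rintro ⟨r, c', h⟩
  -- Invertibility, unlike the determinant, ignores the order of rows and columns, so no signs
  -- appear.
  rw [← isUnit_iff_ne_zero, ← Matrix.isUnit_iff_isUnit_det] at h ⊢
  have : (jetMatrix b S k 1).submatrix r c' =
      ((jetMatrix b S k 1).submatrix (multiIndexEnum n k) c).submatrix
        (r.trans (multiIndexEnum n k).symm) (c'.trans c.symm) := by
    ext; simp
  rwa [this, Matrix.isUnit_submatrix_equiv] at h

variable [LinearOrder A]

/-- The subset of `M` underlying an index of a vector of the standard basis of `⋀^q ℂ^A`. -/
def extSupport {A : Finset M} {q : ℕ} (s : Set.powersetCard A q) : Finset M :=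
  s.1.map (Function.Embedding.subtype _)

theorem sum_extSupport {A : Finset M} {q : ℕ} (s : Set.powersetCard A q) :
    ∑ u ∈ extSupport s, u = extWeight s := by
  simp [extSupport, extWeight]

/-- The Plücker coordinate at `s` is the minor of the jet matrix on the columns in `s`. -/
theorem nonsingularJets_extSupport_iff (s : Set.powersetCard A ((n + k).choose k)) :
    NonsingularJets b (extSupport s) k ↔ (extBasis A _).repr (jetPlucker b A k) s ≠ 0 := by
  let f := Set.powersetCard.ofFinEmbEquiv.symm s
  have hf : ∀ i, f i ∈ s.1 := fun i =>
    (Set.powersetCard.mem_range_ofFinEmbEquiv_symm_iff_mem s _).1 ⟨i, rfl⟩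
  let c : Fin ((n + k).choose k) ≃ extSupport s := Equiv.ofBijective
    (fun i => ⟨f i, Finset.mem_map.2 ⟨f i, hf i, rfl⟩⟩) (by
      constructor
      · intro i j hij
        exact f.injective (Subtype.ext congr(($hij).1))
      · rintro ⟨u, hu⟩
        obtain ⟨a, ha, rfl⟩ := Finset.mem_map.1 hu
        obtain ⟨i, hi⟩ := (Set.powersetCard.mem_range_ofFinEmbEquiv_symm_iff_mem s a).2 ha
        exact ⟨i, Subtype.ext (congrArg (fun a : A => (a : M)) hi)⟩)
  rw [nonsingularJets_iff b k _ c, extBasis, exteriorPower.basis_repr_apply, jetPlucker,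
    exteriorPower.ιMultiDual_apply_ιMulti]
  rfl

theorem mem_jetSums_iff (m : M) : m ∈ jetSums b A k ↔
    ∃ s : Set.powersetCard A ((n + k).choose k),
      (extBasis A _).repr (jetPlucker b A k) s ≠ 0 ∧ extWeight s = m := by
  classical
  simp only [jetSums, Finset.mem_image, Finset.mem_filter, Finset.mem_powersetCard,
    ← nonsingularJets_extSupport_iff, ← sum_extSupport]
  constructor
  · rintro ⟨S, ⟨⟨hSA, hS⟩, hns⟩, rfl⟩
    have h : (S.subtype (· ∈ A)).map (Function.Embedding.subtype _) = S := by
      rw [Finset.subtype_map, Finset.filter_true_of_mem fun u hu => hSA hu]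
    refine ⟨⟨S.subtype (· ∈ A), ?_⟩, ?_⟩
    · rw [Set.powersetCard.mem_iff, ← hS, ← congrArg Finset.card h, Finset.card_map]
    · rw [extSupport, h]
      exact ⟨hns, rfl⟩
  · rintro ⟨s, hs, rfl⟩
    refine ⟨extSupport s, ⟨⟨fun u hu => ?_, ?_⟩, hs⟩, rfl⟩
    · obtain ⟨a, -, rfl⟩ := Finset.mem_map.1 hu
      exact a.2
    · rw [extSupport, Finset.card_map]
      exact s.2

open Classical in
/-- The linear map `ℂ^{B_k} → ⋀^q ℂ^A` that sends the vector of a weight `m ∈ B_k` to the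
component of weight `m` of the Plücker vector of the osculating space at `(1, …, 1)`. -/
def weightMap : (jetSums b A k → ℂ) →ₗ[ℂ] ⋀[ℂ]^((n + k).choose k) (A → ℂ) :=
  (extBasis A _).equivFun.symm.toLinearMap ∘ₗ LinearMap.pi fun s =>
    if h : extWeight s ∈ jetSums b A k then
      (extBasis A _).repr (jetPlucker b A k) s • LinearMap.proj ⟨extWeight s, h⟩
    else 0

open Classical in
theorem repr_weightMap_eq_dite (x : jetSums b A k → ℂ)
    (s : Set.powersetCard A ((n + k).choose k)) :
    (extBasis A _).repr (weightMap b A k x) s =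
      if h : extWeight s ∈ jetSums b A k then
        (extBasis A _).repr (jetPlucker b A k) s * x ⟨extWeight s, h⟩
      else 0 := by
  change (extBasis A _).equivFun ((extBasis A _).equivFun.symm _) s = _
  rw [LinearEquiv.apply_symm_apply, LinearMap.pi_apply]
  split_ifs <;> rfl

theorem repr_weightMap (x : jetSums b A k → ℂ) (s : Set.powersetCard A ((n + k).choose k))
    (h : extWeight s ∈ jetSums b A k) :
    (extBasis A _).repr (weightMap b A k x) s =
      (extBasis A _).repr (jetPlucker b A k) s * x ⟨extWeight s, h⟩ := by
  rw [repr_weightMap_eq_dite, dif_pos h]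

/-- Each `m ∈ B_k` is the weight of some nonzero Plücker coordinate, from which `x m` is recovered.
-/
theorem weightMap_injective : Function.Injective (weightMap b A k) := by
  intro x y hxy
  ext ⟨m, hm⟩
  obtain ⟨s, hs, rfl⟩ := (mem_jetSums_iff b A k m).1 hm
  have := congr((extBasis A _).repr $hxy s)
  rw [repr_weightMap b A k x s hm, repr_weightMap b A k y s hm] at this
  exact mul_left_cancel₀ hs this

/-- Both sides have the same coordinates: the torus scales each Plücker coordinate by its weight,
and those of weight outside `B_k` vanish. -/
theorem weightMap_mon (t : AlgTorus M) :
    weightMap b A k (fun u => (t.mon (u : M) : ℂ)) =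
      exteriorPower.map _ (diagAction A t) (jetPlucker b A k) := by
  refine (extBasis A _).ext_elem fun s => ?_
  rw [extBasis_repr_map_diagAction]
  by_cases h : extWeight s ∈ jetSums b A k
  · rw [repr_weightMap b A k _ s h, mul_comm]
  · have h0 : (extBasis A _).repr (jetPlucker b A k) s = 0 := by
      by_contra hs
      exact h ((mem_jetSums_iff b A k _).2 ⟨s, hs, rfl⟩)
    rw [repr_weightMap_eq_dite, dif_neg h, h0, mul_zero]

end PluckerOfGauss

/-! ### The Gauss map as a toric parametrization -/

section GaussMapEquivariance

variable {M : Type*} [AddCommGroup M] {n : ℕ} {b : Module.Basis (Fin n) ℤ M} {A : Finset M} {k : ℕ}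

theorem jetSums_nonempty (hk : GenericallyJetSpanned b A k) : (jetSums b A k).Nonempty := by
  classical
  -- An arbitrary order on `A`, needed only to index the basis of the exterior power.
  let _ : LinearOrder A := LinearOrder.lift' (Finite.equivFin A) (Finite.equivFin A).injective
  by_contra hne
  refine jetPlucker_ne_zero hk ((extBasis A _).ext_elem fun s => ?_)
  rw [map_zero, Finsupp.zero_apply]
  by_contra hs
  exact hne ⟨_, (mem_jetSums_iff b A k _).2 ⟨s, hs, rfl⟩⟩

variable (b A k) in
/-- The Gauss map, followed by the Plücker embedding, is a linear embedding composed with the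
toric parametrization of `X_{B_k}`. -/
theorem exists_linear_plucker_eq :
    ∃ (j : (jetSums b A k → ℂ) →ₗ[ℂ] ⋀[ℂ]^((n + k).choose k) (A → ℂ))
      (hj : Function.Injective j), ∀ (hB : (jetSums b A k).Nonempty) (t : AlgTorus M),
        pluckerLine ((n + k).choose k) (gaussMap b A k t) =
          (Projectivization.map j hj (toricMap (jetSums b A k) hB t)).submodule := by
  let _ : LinearOrder A := LinearOrder.lift' (Finite.equivFin A) (Finite.equivFin A).injective
  refine ⟨weightMap b A k, weightMap_injective b A k, fun hB t => ?_⟩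
  rw [pluckerLine_gaussMap, toricMap, Projectivization.map_mk, Projectivization.submodule_mk,
    weightMap_mon]

theorem image_toricVariety_jetSums (hB : (jetSums b A k).Nonempty)
    {j : (jetSums b A k → ℂ) →ₗ[ℂ] ⋀[ℂ]^((n + k).choose k) (A → ℂ)} (hj : Function.Injective j)
    (h : ∀ t : AlgTorus M, pluckerLine ((n + k).choose k) (gaussMap b A k t) =
      (Projectivization.map j hj (toricMap (jetSums b A k) hB t)).submodule) :
    Projectivization.map j hj '' toricVariety (jetSums b A k) = osculatingVariety b A k := by
  rw [toricVariety_eq _ hB, image_map_zariskiClosure, osculatingVariety, ← Set.range_comp]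
  congr 1
  ext p
  refine exists_congr fun t => ?_
  rw [h, Projectivization.submodule_injective.eq_iff, eq_comm]
  rfl

/-- Two points of the torus have the same osculating space if and only if they agree on
`⟨B_k - B_k⟩`. -/
theorem gaussMap_eq_iff (hk : GenericallyJetSpanned b A k) (s t : AlgTorus M) :
    gaussMap b A k s = gaussMap b A k t ↔
      ∀ m ∈ diffLattice (jetSums b A k), s.mon m = t.mon m := by
  have hB := jetSums_nonempty hk
  obtain ⟨j, hj, h⟩ := exists_linear_plucker_eq b A k
  rw [← toricMap_eq_iff_diffLattice _ hB, ← (Projectivization.map_injective j hj).eq_iff,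
    ← Projectivization.submodule_injective.eq_iff, ← h, ← h,
    pluckerLine_inj (finrank_gaussMap hk s) (finrank_gaussMap hk t)]

end GaussMapEquivariance

/-! ### Saturation of a sublattice -/

section Saturation

variable {M : Type*} [AddCommGroup M]

/-- The lattice points in the real span of a sublattice are those with a multiple in it. -/
theorem mem_realSpanInter_iff [Module.Finite ℤ M] (L : AddSubgroup M) (m : M) :
    m ∈ realSpanInter L ↔ ∃ N : ℤ, N ≠ 0 ∧ N • m ∈ L := by
  constructor
  · intro hm
    by_contra! hL
    -- If no nonzero multiple of `m` lies in `L`, then `m` survives in `M / L` modulo torsion, which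
    -- is free. A coordinate there is an integral functional `φ` that kills `L` but not `m`; its
    -- base change to `ℝ` excludes `m` from the real span.
    let Q := M ⧸ AddSubgroup.toIntSubmodule L
    let π : M →ₗ[ℤ] Q := (AddSubgroup.toIntSubmodule L).mkQ
    let T := Submodule.torsion ℤ Q
    let ρ : Q →ₗ[ℤ] Q ⧸ T := T.mkQ
    have hne : ρ (π m) ≠ 0 := by
      intro h0
      obtain ⟨a, ha⟩ := (Submodule.Quotient.mk_eq_zero T).1 h0
      refine hL a (nonZeroDivisors.coe_ne_zero a) ?_
      have : π ((a : ℤ) • m) = 0 := by rw [map_smul]; exact ha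
      exact (Submodule.Quotient.mk_eq_zero _).1 this
    let e := Module.Free.chooseBasis ℤ (Q ⧸ T)
    obtain ⟨i, hi⟩ : ∃ i, e.coord i (ρ (π m)) ≠ 0 := by
      by_contra! h
      exact hne (e.ext_elem fun i => by simpa using h i)
    let φ : M →ₗ[ℤ] ℤ := e.coord i ∘ₗ ρ ∘ₗ π
    have hφL : ∀ l ∈ L, φ l = 0 := fun l hl => by
      have : π l = 0 := (Submodule.Quotient.mk_eq_zero _).2 hl
      simp [φ, this]
    let Φ : ℝ ⊗[ℤ] M →ₗ[ℝ] ℝ ⊗[ℤ] ℤ := φ.baseChange ℝ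
    have hle : Submodule.span ℝ ((fun m : M => (1 : ℝ) ⊗ₜ[ℤ] m) '' (L : Set M)) ≤
        LinearMap.ker Φ := by
      rw [Submodule.span_le]
      rintro _ ⟨l, hl, rfl⟩
      simp [Φ, hφL l hl]
    have h1 : Φ ((1 : ℝ) ⊗ₜ[ℤ] m) = 0 := hle hm
    have h2 := congr(TensorProduct.rid ℤ ℝ $h1)
    simp only [Φ, LinearMap.baseChange_tmul, TensorProduct.rid_tmul, map_zero, zsmul_eq_mul,
      mul_one, Int.cast_eq_zero] at h2
    exact hi h2
  · rintro ⟨N, hN, hNm⟩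
    have h : (1 : ℝ) ⊗ₜ[ℤ] (N • m) ∈
        Submodule.span ℝ ((fun m : M => (1 : ℝ) ⊗ₜ[ℤ] m) '' (L : Set M)) :=
      Submodule.subset_span ⟨_, hNm, rfl⟩
    have h2 := Submodule.smul_mem _ ((N : ℝ)⁻¹) h
    rw [TensorProduct.tmul_smul, ← Int.cast_smul_eq_zsmul ℝ, smul_smul,
      inv_mul_cancel₀ (by exact_mod_cast hN), one_smul] at h2
    exact h2

theorem le_realSpanInter (L : AddSubgroup M) : L ≤ realSpanInter L :=
  fun m hm => Submodule.subset_span ⟨m, hm, rfl⟩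

variable [Module.Finite ℤ M] (L : AddSubgroup M)

instance isTorsionFree_quotient_realSpanInter :
    Module.IsTorsionFree ℤ (M ⧸ realSpanInter L) := by
  refine Module.IsTorsionFree.of_smul_eq_zero fun r q hq => ?_
  by_contra! h
  obtain ⟨m, rfl⟩ := QuotientAddGroup.mk_surjective q
  have hm : r • m ∈ realSpanInter L := (QuotientAddGroup.eq_zero_iff _).1 hq
  obtain ⟨N, hN, hNm⟩ := (mem_realSpanInter_iff L _).1 hm
  refine h.2 ((QuotientAddGroup.eq_zero_iff m).2 ((mem_realSpanInter_iff L m).2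
    ⟨N * r, mul_ne_zero hN h.1, ?_⟩))
  rwa [mul_smul]

instance finite_quotient_realSpanInter : Module.Finite ℤ (M ⧸ realSpanInter L) :=
  Module.Finite.of_surjective (QuotientAddGroup.mk' (realSpanInter L)).toIntLinearMap
    (QuotientAddGroup.mk'_surjective _)

instance free_quotient_realSpanInter : Module.Free ℤ (M ⧸ realSpanInter L) :=
  Module.free_of_finite_type_torsion_free'

/-- The quotient `S / L` is torsion, hence of rank `0`. -/
theorem finrank_eq_of_forall_smul_mem {L S : Submodule ℤ M} (hLS : L ≤ S)
    (h : ∀ m ∈ S, ∃ N : ℤ, N ≠ 0 ∧ N • m ∈ L) : Module.finrank ℤ L = Module.finrank ℤ S := by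
  have htors : Module.IsTorsion ℤ (S ⧸ L.submoduleOf S) := by
    intro q
    obtain ⟨m, rfl⟩ := Submodule.Quotient.mk_surjective _ q
    obtain ⟨N, hN, hNm⟩ := h m m.2
    exact ⟨⟨N, mem_nonZeroDivisors_of_ne_zero hN⟩, (Submodule.Quotient.mk_eq_zero _).2 hNm⟩
  have h1 := Submodule.finrank_quotient_add_finrank (L.submoduleOf S)
  rw [Module.finrank_eq_zero_iff_isTorsion.2 htors, zero_add] at h1
  rw [← h1]
  exact (Submodule.submoduleOfEquivOfLe hLS).finrank_eq.symm

theorem finrank_quotient_realSpanInter_add :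
    Module.finrank ℤ (M ⧸ realSpanInter L) + Module.finrank ℤ L = Module.finrank ℤ M := by
  have h1 := Submodule.finrank_quotient_add_finrank (AddSubgroup.toIntSubmodule (realSpanInter L))
  have h2 : Module.finrank ℤ L = Module.finrank ℤ (AddSubgroup.toIntSubmodule (realSpanInter L)) :=
    finrank_eq_of_forall_smul_mem (L := AddSubgroup.toIntSubmodule L) (le_realSpanInter L)
      fun m hm => (mem_realSpanInter_iff L m).1 hm
  rw [h2, ← h1]
  congr 1

end Saturation

theorem finite_units_zpow_eq {N : ℤ} (hN : N ≠ 0) (a : ℂˣ) : {c : ℂˣ | c ^ N = a}.Finite := by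
  have key : ∀ k : ℕ, k ≠ 0 → ∀ a : ℂˣ, {c : ℂˣ | c ^ k = a}.Finite := fun k hk a => by
    refine Set.Finite.of_finite_image (f := Units.val) ?_ Units.val_injective.injOn
    refine (Polynomial.nthRoots k (a : ℂ)).toFinset.finite_toSet.subset ?_
    rintro _ ⟨c, hc, rfl⟩
    have hc' : (c : ℂ) ^ k = a := by
      rw [← Units.val_pow_eq_pow_val]
      exact congrArg Units.val hc
    simpa [Polynomial.mem_nthRoots (Nat.pos_of_ne_zero hk)] using hc'
  obtain ⟨k, rfl | rfl⟩ := N.eq_nat_or_neg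
  · simpa using key k (by simpa using hN) a
  · simpa [inv_eq_iff_eq_inv] using key k (by simpa using hN) a⁻¹

/-! ### Irreducible components of the fibers -/

section Fibers

variable {M : Type*} [AddCommGroup M]

/-- The coset of the subtorus `T_{M / (L_ℝ ∩ M)}` through `g`. -/
def subtorusCoset (L : AddSubgroup M) (g : AlgTorus M) : Set (AlgTorus M) :=
  Set.range fun s => g * AlgTorus.map (QuotientAddGroup.mk' (realSpanInter L)) s

theorem mem_subtorusCoset_iff (L : AddSubgroup M) (g t : AlgTorus M) :
    t ∈ subtorusCoset L g ↔ ∀ m ∈ realSpanInter L, t.mon m = g.mon m := by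
  have h : t ∈ subtorusCoset L g ↔
      t / g ∈ Set.range (AlgTorus.map (QuotientAddGroup.mk' (realSpanInter L))) := by
    simp only [subtorusCoset, Set.mem_range, eq_div_iff_mul_eq', mul_comm g]
  rw [h, AlgTorus.range_map_mk']
  simp [div_eq_one]

theorem subtorusCoset_subset (L : AddSubgroup M) {g t₀ : AlgTorus M}
    (hg : ∀ m ∈ L, g.mon m = t₀.mon m) :
    subtorusCoset L g ⊆ {t | ∀ m ∈ L, t.mon m = t₀.mon m} := fun t ht m hm =>
  ((mem_subtorusCoset_iff L g t).1 ht m (le_realSpanInter L hm)).trans (hg m hm)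

variable [Module.Finite ℤ M] (L : AddSubgroup M)

theorem isIrreducible_subtorusCoset (g : AlgTorus M) : IsIrreducible (subtorusCoset L g) := by
  rw [subtorusCoset, ← Set.image_univ]
  exact (AlgTorus.isIrreducible_univ (Module.Free.chooseBasis ℤ _)).image _
    (AlgTorus.isInducing_mul_map _ (QuotientAddGroup.mk'_surjective _) g).continuous.continuousOn

/-- An irreducible set of points that agree on `L` lies in one coset of the subtorus. -/
theorem subset_subtorusCoset_of_isIrreducible {t₀ : AlgTorus M} {F : Set (AlgTorus M)}
    (hF : IsIrreducible F) (hFL : F ⊆ {t | ∀ m ∈ L, t.mon m = t₀.mon m}) {g : AlgTorus M}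
    (hg : g ∈ F) : F ⊆ subtorusCoset L g := by
  intro t ht
  rw [mem_subtorusCoset_iff]
  intro m hm
  obtain ⟨N, hN, hNm⟩ := (mem_realSpanInter_iff L m).1 hm
  classical
  -- On `F` the value `c = t(m)` satisfies `c ^ N = t₀(N • m)`. So `F` is covered by finitely many
  -- closed level sets of `m`, and irreducibility puts it in one of them.
  have hfin := finite_units_zpow_eq hN (t₀.mon (N • m))
  let Z : Finset (Set (AlgTorus M)) :=
    (Set.Finite.toFinset hfin).image fun c => {t : AlgTorus M | t.mon m = c}
  obtain ⟨z, hz, hFz⟩ := isIrreducible_iff_sUnion_isClosed.1 hF Z (fun z hz => by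
      obtain ⟨c, -, rfl⟩ := Finset.mem_image.1 hz
      exact AlgTorus.isClosed_mon_eq _ _) (fun s hs => by
      refine Set.mem_sUnion.2 ⟨{t | t.mon m = s.mon m}, ?_, rfl⟩
      refine Finset.mem_coe.2 (Finset.mem_image.2 ⟨s.mon m, ?_, rfl⟩)
      rw [Set.Finite.mem_toFinset]
      have := hFL hs (N • m) hNm
      simpa using this)
  obtain ⟨c, -, rfl⟩ := Finset.mem_image.1 hz
  exact (hFz ht).trans (hFz hg).symm

theorem exists_eq_subtorusCoset {t₀ : AlgTorus M} {F : Set (AlgTorus M)}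
    (hF : IsIrredComponent {t : AlgTorus M | ∀ m ∈ L, t.mon m = t₀.mon m} F) :
    ∃ g, F = subtorusCoset L g := by
  obtain ⟨⟨hirr, hsub⟩, hmax⟩ := hF
  obtain ⟨g, hg⟩ := hirr.nonempty
  have h := subset_subtorusCoset_of_isIrreducible L hirr hsub hg
  -- The coset is itself irreducible and contained in the fiber, so maximality of `F` gives
  -- equality.
  exact ⟨g, h.antisymm
    (hmax ⟨isIrreducible_subtorusCoset L g, subtorusCoset_subset L (hsub hg)⟩ h)⟩

theorem topologicalKrullDim_quotient_torus :
    topologicalKrullDim (AlgTorus (M ⧸ realSpanInter L)) =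
      Module.finrank ℤ (M ⧸ realSpanInter L) :=
  AlgTorus.topologicalKrullDim_eq (Module.finBasis ℤ _)

end Fibers

/-- The dimension of a space is bounded by the dimensions of its irreducible closed subsets. -/
theorem topologicalKrullDim_le_of_irreducibleCloseds {X : Type*} [TopologicalSpace X]
    {d : WithBot ℕ∞} (h : ∀ C : Set X, IsIrreducible C → IsClosed C → topologicalKrullDim C ≤ d) :
    topologicalKrullDim X ≤ d := by
  refine iSup_le fun p => ?_
  -- The whole chain lies inside its largest member `C`, so its length is bounded by the dimension
  -- of `C`.
  let C := p.last
  have h1 : (p.length : WithBot ℕ∞) ≤ Order.krullDim (Set.Iic C) := by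
    rw [← Order.height_eq_krullDim_Iic]
    exact_mod_cast Order.length_le_height_last
  refine h1.trans (le_trans ?_ (h C C.2 C.3))
  have hirr : ∀ D : Set.Iic C,
      IsIrreducible (Subtype.val ⁻¹' (D.1 : Set X) : Set (C : Set X)) := fun D => by
    refine ⟨?_, ?_⟩
    · obtain ⟨x, hx⟩ := D.1.2.nonempty
      exact ⟨⟨x, D.2 hx⟩, hx⟩
    · rintro _ _ ⟨U, hU, rfl⟩ ⟨V, hV, rfl⟩ ⟨x, hxD, hxU⟩ ⟨y, hyD, hyV⟩
      obtain ⟨z, hzD, hz⟩ := D.1.2.isPreirreducible U V hU hV ⟨x, hxD, hxU⟩ ⟨y, hyD, hyV⟩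
      exact ⟨⟨z, D.2 hzD⟩, hzD, hz⟩
  refine Order.krullDim_le_of_strictMono (fun D : Set.Iic C =>
    (⟨Subtype.val ⁻¹' (D.1 : Set X), hirr D, D.1.3.preimage continuous_subtype_val⟩ :
      TopologicalSpace.IrreducibleCloseds (C : Set X))) fun D E hDE => ?_
  refine lt_of_le_not_ge (fun x hx => hDE.le hx) fun hle => hDE.not_ge fun x hx => ?_
  exact hle (show (⟨x, E.2 hx⟩ : (C : Set X)) ∈ Subtype.val ⁻¹' (E.1 : Set X) from hx)

/-! ### Dimension of the fibers -/

section FiberDimension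

variable {M : Type*} [AddCommGroup M] [Module.Finite ℤ M] (L : AddSubgroup M)

/-- Above: each irreducible closed subset lies in a coset, so it embeds topologically in `T_{M'}`.
Below: the coset through `t₀` lies in the fiber. -/
theorem topologicalKrullDim_fiber (t₀ : AlgTorus M) :
    topologicalKrullDim {t : AlgTorus M | ∀ m ∈ L, t.mon m = t₀.mon m} =
      Module.finrank ℤ (M ⧸ realSpanInter L) := by
  have hind := fun g : AlgTorus M =>
    AlgTorus.isInducing_mul_map _ (QuotientAddGroup.mk'_surjective (realSpanInter L)) g
  rw [← topologicalKrullDim_quotient_torus]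
  apply le_antisymm
  · refine topologicalKrullDim_le_of_irreducibleCloseds fun C hC _ => ?_
    obtain ⟨g, hg⟩ := hC.nonempty
    have hsub := subset_subtorusCoset_of_isIrreducible L (t₀ := t₀)
      (hC.image Subtype.val continuous_subtype_val.continuousOn)
      (by rintro _ ⟨x, -, rfl⟩; exact x.2) ⟨g, hg, rfl⟩
    have hex : ∀ c : C, ∃ s, (g : AlgTorus M) *
        AlgTorus.map (QuotientAddGroup.mk' (realSpanInter L)) s = c.1.1 := fun c =>
      hsub ⟨c.1, c.2, rfl⟩
    choose f hf using hex
    -- Composed with the inducing parametrization of the coset, `f` becomes the inclusion of `C` in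
    -- the torus.
    have hfi : Topology.IsInducing f := by
      rw [← (hind g).of_comp_iff]
      convert! Topology.IsInducing.subtypeVal.comp Topology.IsInducing.subtypeVal using 1
      exact funext hf
    exact hfi.topologicalKrullDim_le
  · have hmem : ∀ s, t₀ * AlgTorus.map (QuotientAddGroup.mk' (realSpanInter L)) s ∈
        {t : AlgTorus M | ∀ m ∈ L, t.mon m = t₀.mon m} := fun s =>
      subtorusCoset_subset L (fun _ _ => rfl) ⟨s, rfl⟩
    exact ((hind t₀).codRestrict hmem).topologicalKrullDim_le

end FiberDimension

end ToricGauss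

end

/-! ### The main theorem -/

theorem theorem4p3 {M : Type*} [AddCommGroup M] {n : ℕ} (b : Module.Basis (Fin n) ℤ M)
    (A : Finset M) (hA : A.Nonempty) (k : ℕ) (hk : ToricGauss.GenericallyJetSpanned b A k) :
    -- `γ^k` is a well defined map on the dense torus `φ_A(T_M)` of `X_A`, with values in the
    -- Grassmannian of `C(n+k, k)`-dimensional subspaces
    ((∀ t, Module.finrank ℂ (ToricGauss.gaussMap b A k t) = (n + k).choose k) ∧
      ∀ s t, ToricGauss.toricMap A hA s = ToricGauss.toricMap A hA t →
        ToricGauss.gaussMap b A k s = ToricGauss.gaussMap b A k t) ∧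
    -- (i)
    ToricGauss.ProjEquiv (ToricGauss.osculatingVariety b A k)
      (ToricGauss.toricVariety (ToricGauss.jetSums b A k)) ∧
    -- (ii)
    ((ToricGauss.jetSums b A k).Nonempty ∧
      Function.Surjective
        (ToricGauss.AlgTorus.map
          (ToricGauss.diffLattice (ToricGauss.jetSums b A k)).subtype) ∧
      (∀ (u₀ : M) (h₀ : u₀ ∈ ToricGauss.jetSums b A k),
        Function.Injective (ToricGauss.torusInclusion (ToricGauss.jetSums b A k) u₀ h₀)) ∧
      ∃ (j : (ToricGauss.jetSums b A k → ℂ) →ₗ[ℂ] ⋀[ℂ]^((n + k).choose k) (A → ℂ))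
        (hj : Function.Injective j),
        Projectivization.map j hj '' ToricGauss.toricVariety (ToricGauss.jetSums b A k) =
            ToricGauss.osculatingVariety b A k ∧
        ∀ (u₀ : M) (h₀ : u₀ ∈ ToricGauss.jetSums b A k) (t : ToricGauss.AlgTorus M),
          ToricGauss.pluckerLine ((n + k).choose k) (ToricGauss.gaussMap b A k t) =
            (Projectivization.map j hj
              (ToricGauss.torusInclusion (ToricGauss.jetSums b A k) u₀ h₀
                (ToricGauss.AlgTorus.map
                  (ToricGauss.diffLattice (ToricGauss.jetSums b A k)).subtype t))).submodule) ∧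
    -- (iii)
    (∀ t₀ : ToricGauss.AlgTorus M,
      (∀ F : Set (ToricGauss.AlgTorus M),
        ToricGauss.IsIrredComponent (ToricGauss.gaussFiber b A k t₀) F →
        (∃ g : ToricGauss.AlgTorus M,
          F = Set.range fun s =>
            g * ToricGauss.AlgTorus.map
              (QuotientAddGroup.mk' (ToricGauss.realSpanInter
                (ToricGauss.diffLattice (ToricGauss.jetSums b A k)))) s) ∧
        ToricGauss.ProjEquiv
          (ToricGauss.zariskiClosure (ToricGauss.toricMap A hA '' F))
          (ToricGauss.toricVariety
            (ToricGauss.projSet (ToricGauss.realSpanInter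
              (ToricGauss.diffLattice (ToricGauss.jetSums b A k))) A))) ∧
      topologicalKrullDim (ToricGauss.gaussFiber b A k t₀) =
        (Module.finrank ℤ (M ⧸ ToricGauss.realSpanInter
          (ToricGauss.diffLattice (ToricGauss.jetSums b A k))) : WithBot ℕ∞)) ∧
    (Module.finrank ℤ (M ⧸ ToricGauss.realSpanInter
        (ToricGauss.diffLattice (ToricGauss.jetSums b A k))) : ℤ) =
      n - Module.finrank ℤ (ToricGauss.diffLattice (ToricGauss.jetSums b A k)) := by
  have : Module.Finite ℤ M := Module.Finite.of_basis b
  have hB := ToricGauss.jetSums_nonempty hk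
  obtain ⟨j, hj, hjt⟩ := ToricGauss.exists_linear_plucker_eq b A k
  have himage := ToricGauss.image_toricVariety_jetSums hB hj (hjt hB)
  have hfiber : ∀ t₀, ToricGauss.gaussFiber b A k t₀ = {t : ToricGauss.AlgTorus M |
      ∀ m ∈ ToricGauss.diffLattice (ToricGauss.jetSums b A k), t.mon m = t₀.mon m} := fun t₀ =>
    Set.ext fun t => ToricGauss.gaussMap_eq_iff hk t t₀
  refine ⟨⟨ToricGauss.finrank_gaussMap hk, ToricGauss.gaussMap_eq_of_toricMap_eq hA⟩, ?_,
    ⟨hB, ToricGauss.AlgTorus.map_surjective_of_injective _ Subtype.val_injective,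
      ToricGauss.torusInclusion_injective _, j, hj, himage, fun u₀ h₀ t => ?_⟩,
    fun t₀ => ⟨fun F hF => ?_, ?_⟩, ?_⟩
  · have : Nonempty (ToricGauss.jetSums b A k) := hB.to_subtype
    have : Nontrivial (⋀[ℂ]^((n + k).choose k) (A → ℂ)) := hj.nontrivial
    exact ToricGauss.projEquiv_of_image_eq j hj himage
  · rw [ToricGauss.torusInclusion_map]
    exact hjt _ t
  · rw [hfiber] at hF
    obtain ⟨g, rfl⟩ := ToricGauss.exists_eq_subtorusCoset _ hF
    exact ⟨⟨g, rfl⟩, ToricGauss.projEquiv_toricVariety_projSet A hA _ g⟩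
  · rw [hfiber]
    exact ToricGauss.topologicalKrullDim_fiber _ t₀
  · have h := ToricGauss.finrank_quotient_realSpanInter_add
      (ToricGauss.diffLattice (ToricGauss.jetSums b A k))
    rw [Module.finrank_eq_card_basis b, Fintype.card_fin] at h
    omega
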